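/- Let $G$ be a finite simple graph that is a block graph, i.e. every block of $G$ (every maximal connected subgraph without a cut vertex of its own) is a clique. For $r\ge 2$ let $\mathcal{C}_r(G)$ be the $(r+1)$-uniform clutter on $V(G)$ whose edges are the sets $S\subseteq V(G)$ with $|S|=r+1$ and $G[S]$ connected. A $d$-uniform clutter $\mathcal{C}$ on a finite set $V$ is a family $E(\mathcal{C})$ of $d$-subsets of $V$. A set $W\subseteq V$ is a clique of $\mathcal{C}$ if every $d$-subset of $W$ is an edge. For a $(d-1)$-subset $\sigma\subseteq V$ put $N_{\mathcal{C}}[\sigma]=\sigma\cup\{v\in V:\sigma\cup\{v\}\in E(\mathcal{C})\}$; $\sigma$ is a simplicial maximal subedge if $N_{\mathcal{C}}[\sigma]\ne\sigma$ and $N_{\mathcal{C}}[\sigma]$ is a clique. Let $\mathcal{C}\setminus\sigma$ be the clutter whose edges are the $e\in E(\mathcal{C})$ with $\sigma\not\subseteq e$. Recursively, $\mathcal{C}$ is chordal if $E(\mathcal{C})=\emptyset$ or $\mathcal{C}\setminus\sigma$ is chordal for some simplicial maximal subedge $\sigma$. The complement $\overline{\mathcal{C}}$ has as edges the $d$-subsets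 of $V$ that are not edges of $\mathcal{C}$, and the edge ideal of a clutter over a field $\mathbb{K}$ is $I(\mathcal{C})=\big(\prod_{x\in e}x : e\in E(\mathcal{C})\big)\subseteq R=\mathbb{K}[x : x\in V]$. A homogeneous ideal $I$ of $R$ has a $d$-linear resolution if its (finite) minimal graded free resolution $\cdots\to F_1\to F_0\to I\to 0$ satisfies $F_i\cong R(-d-i)^{\beta_i}$ for all $i\ge 0$ (the zero ideal included). \textbf{Theorem.} If $G$ is a block graph, then for every $r\ge 2$ the clutter $\mathcal{C}_r(G)$ is chordal. Consequently, over every field $\mathbb{K}$, the edge ideal $I\big(\overline{\mathcal{C}_r(G)}\big)$ of the complement clutter has a linear resolution, namely an $(r+1)$-linear one. -/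

import Mathlib

/-! ### Block graphs -/

namespace SimpleGraph

/-- A subgraph without a cut vertex: it is connected, and stays connected whenever one of its
vertices is deleted (`Preconnected` admits the empty graph that is left over from one vertex).
These are the 2-connected subgraphs, single edges and single vertices being allowed as usual in
the definition of a block. -/
def Subgraph.IsNonseparable {V : Type*} {G : SimpleGraph V} (H : G.Subgraph) : Prop :=
  H.Connected ∧ ∀ v ∈ H.verts, (H.deleteVerts {v}).Preconnected

/-- A block of `G`: a maximal nonseparable subgraph. -/
def Subgraph.IsBlock {V : Type*} {G : SimpleGraph V} (B : G.Subgraph) : Prop :=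
  Maximal (fun H : G.Subgraph => H.IsNonseparable) B

/-- A block graph: every block is a clique. -/
def IsBlockGraph {V : Type*} (G : SimpleGraph V) : Prop :=
  ∀ B : G.Subgraph, B.IsBlock → G.IsClique B.verts

end SimpleGraph

/-! ### Uniform clutters -/

/-- A `d`-uniform clutter on the vertex set `V`: a family of `d`-element subsets of `V`. -/
@[ext]
structure UniformClutter (V : Type*) (d : ℕ) where
  edges : Set (Finset V)
  card_eq : ∀ e ∈ edges, e.card = d

namespace UniformClutter

/-- The complement clutter: all `d`-subsets of `V` that are not edges. -/
def complement {V : Type*} {d : ℕ} (C : UniformClutter V d) : UniformClutter V d where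
  edges := {e | e.card = d ∧ e ∉ C.edges}
  card_eq := fun _ he => he.1

/-- A clique: a set of vertices all of whose `d`-subsets are edges. -/
def IsClique {V : Type*} {d : ℕ} (C : UniformClutter V d) (W : Set V) : Prop :=
  ∀ e : Finset V, (e : Set V) ⊆ W → e.card = d → e ∈ C.edges

/-- The closed neighborhood `N[σ] = σ ∪ {v | σ ∪ {v} is an edge}`. -/
def closedNeighborhood {V : Type*} [DecidableEq V] {d : ℕ} (C : UniformClutter V d)
    (σ : Finset V) : Set V :=
  (σ : Set V) ∪ {v | insert v σ ∈ C.edges}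

/-- A maximal subedge: a `(d - 1)`-subset `σ` with `N[σ] ≠ σ`. -/
def IsMaximalSubedge {V : Type*} [DecidableEq V] {d : ℕ} (C : UniformClutter V d)
    (σ : Finset V) : Prop :=
  σ.card + 1 = d ∧ C.closedNeighborhood σ ≠ (σ : Set V)

/-- A simplicial maximal subedge: a maximal subedge whose closed neighborhood is a clique. -/
def IsSimplicial {V : Type*} [DecidableEq V] {d : ℕ} (C : UniformClutter V d)
    (σ : Finset V) : Prop :=
  C.IsMaximalSubedge σ ∧ C.IsClique (C.closedNeighborhood σ)

/-- The deletion `C \ σ`: all edges that do not contain `σ`. -/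
def deletion {V : Type*} {d : ℕ} (C : UniformClutter V d) (σ : Finset V) :
    UniformClutter V d where
  edges := {e | e ∈ C.edges ∧ ¬ σ ⊆ e}
  card_eq := fun e he => C.card_eq e he.1

/-- Chordal clutters: either there is no edge, or deleting some simplicial maximal subedge leaves
a chordal clutter. -/
inductive IsChordal {V : Type*} [DecidableEq V] {d : ℕ} : UniformClutter V d → Prop
  | empty (C : UniformClutter V d) (h : C.edges = ∅) : IsChordal C
  | step (C : UniformClutter V d) (σ : Finset V) (hσ : C.IsSimplicial σ)
      (h : IsChordal (C.deletion σ)) : IsChordal C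

/-- The edge ideal, generated by the monomials `∏ x ∈ e, X x` for the edges `e`. -/
noncomputable def edgeIdeal {V : Type*} {d : ℕ} (K : Type*) [Field K] (C : UniformClutter V d) :
    Ideal (MvPolynomial V K) :=
  Ideal.span {m | ∃ e ∈ C.edges, m = ∏ x ∈ e, MvPolynomial.X x}

end UniformClutter

/-- The clutter of the connected `(r + 1)`-subsets of the vertex set of a graph. -/
def SimpleGraph.connectedClutter {V : Type*} (G : SimpleGraph V) (r : ℕ) :
    UniformClutter V (r + 1) where
  edges := {S | S.card = r + 1 ∧ (G.induce (S : Set V)).Connected}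
  card_eq := fun _ hS => hS.1

/-! ### Graded free resolutions -/

/-- A graded free resolution of finite length of an ideal `I` of `R = K[x_v : v ∈ V]`, by free
modules of finite rank:
`0 ⟶ F_p ⟶ ⋯ ⟶ F_1 ⟶ F_0 ⟶ I ⟶ 0` with `F_i = ⨁_b R(-deg i b)`, where `b` runs over `rank i`
basis elements and `deg i b` is the degree of the basis element `b` of `F_i`. The map
`F_(i+1) ⟶ F_i` is given by the matrix `diff i`, and `F_0 ⟶ I` sends the basis to `gen`. All maps
preserve degrees. -/
structure GradedFreeResolution {V K : Type*} [Field K] (I : Ideal (MvPolynomial V K)) where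
  rank : ℕ → ℕ
  deg : (i : ℕ) → Fin (rank i) → ℕ
  gen : Fin (rank 0) → MvPolynomial V K
  diff : (i : ℕ) → Matrix (Fin (rank i)) (Fin (rank (i + 1))) (MvPolynomial V K)
  gen_homogeneous : ∀ b, (gen b).IsHomogeneous (deg 0 b)
  diff_homogeneous : ∀ i a b, diff i a b = 0 ∨
    ∃ n : ℕ, n + deg i a = deg (i + 1) b ∧ (diff i a b).IsHomogeneous n
  span_gen : Ideal.span (Set.range gen) = I
  exact_zero : Function.Exact (diff 0).mulVecLin (Fintype.linearCombination (MvPolynomial V K) gen)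
  exact_succ : ∀ i, Function.Exact (diff (i + 1)).mulVecLin (diff i).mulVecLin
  finite_length : ∃ p : ℕ, ∀ i, p < i → rank i = 0

namespace GradedFreeResolution

/-- A resolution is minimal if the image of each `F_(i+1) ⟶ F_i` lies in `𝔪 F_i`, where `𝔪` is the
ideal generated by the variables: the matrix entries have no constant term. -/
def IsMinimal {V K : Type*} [Field K] {I : Ideal (MvPolynomial V K)}
    (F : GradedFreeResolution I) : Prop :=
  ∀ i a b, MvPolynomial.constantCoeff (F.diff i a b) = 0

/-- The number of copies of `R(-j)` in `F_i`; if `F` is minimal this is the graded Betti number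
`β_{i,j}(I)`. -/
def betti {V K : Type*} [Field K] {I : Ideal (MvPolynomial V K)}
    (F : GradedFreeResolution I) (i j : ℕ) : ℕ :=
  Fintype.card {b : Fin (F.rank i) // F.deg i b = j}

end GradedFreeResolution

/-- `I` has a `d`-linear resolution: in its minimal graded free resolution (which is unique up to
isomorphism) `F_i` is a direct sum of copies of `R(-d-i)`. The zero ideal, with `F_i = 0` for all
`i`, is included. -/
def HasLinearResolution {V K : Type*} [Field K] (I : Ideal (MvPolynomial V K)) (d : ℕ) : Prop :=
  ∃ F : GradedFreeResolution I, F.IsMinimal ∧ ∀ i j, j ≠ i + d → F.betti i j = 0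

/-! ### Cycles and cut vertices in block graphs. -/

namespace SimpleGraph

variable {V : Type*} {G : SimpleGraph V}

/-! In a block graph the vertices of any cycle form a clique, since a cycle is nonseparable and so
lies in a block. This is the only way in which the hypothesis on `G` enters, apart from its direct
use on `G[S]` in `exists_cut_vertex`.

Chordality. Let `S` be a connected `(r + 1)`-set that is not a clique. Then `G[S]` has a cut vertex
`w`, and no other vertex `v` can replace it: two neighbors of `w` in different components of `S \
{w}`, joined through `v`, would lie on a cycle with `w` and hence be adjacent. So the closed
neighborhood of `S \ {w}` is `S`, and deleting this subedge removes the edge `S` alone. Once all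
edges are cliques, order the vertices and delete subedges `σ` in increasing order of their last
vertex. The remaining edges are always governed by an upper set of subedges, which makes each `σ`
simplicial when its turn comes (`isChordal_of_upperSet`).

Linearity. Let `σ` be simplicial in `C`, let `I` be the ideal of the complement of `C`, and let `J =
(x_σ x_v : v ∉ σ)`. Then `I + J` is the ideal of the complement of `C \ σ`, and `I ∩ J = x_σ (x_v :
v ∉ N[σ])` has a linear resolution. If `I + J` is `d`-linear too, the sequence `0 → I ∩ J → I × J →
I + J → 0` makes `I × J` linear, and so its retract `I`. Induction along the deletions ends at the
ideal of all squarefree monomials of degree `d`.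

Resolutions are handled without homological algebra: `IsLinearModule` asks recursively that the
kernel of `A ⊗ W → M` be generated by its linear part. Extensions, certain cokernels and retracts
preserve this; at the end bases turn the recursion into matrices of linear forms. -/

theorem IsBlockGraph.isClique_of_isNonseparable [Finite V] (hG : G.IsBlockGraph)
    {H : G.Subgraph} (hH : H.IsNonseparable) : G.IsClique H.verts := by
  obtain ⟨B, hHB, hB⟩ := (Set.toFinite {H : G.Subgraph | H.IsNonseparable}).exists_le_maximal hH
  exact (hG B hB).subset hHB.1

/-- Rotate the cycle so that the deleted vertex `v` is its base point. What remains lies on a path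
that starts at the second vertex `x` and meets `v` only at its end, so each initial segment ending
before `v` survives the deletion and joins `x` to its endpoint. -/
theorem Walk.IsCycle.isNonseparable_toSubgraph [DecidableEq V] {u : V} {c : G.Walk u u}
    (hc : c.IsCycle) : c.toSubgraph.IsNonseparable := by
  refine ⟨c.toSubgraph_connected, fun v hv => ?_⟩
  rw [Walk.mem_verts_toSubgraph] at hv
  have hc' := hc.rotate hv
  rw [← Walk.toSubgraph_rotate c hv]
  generalize c.rotate v hv = c' at hc'
  clear hc hv c
  cases c' with
  | nil => exact absurd hc' Walk.not_isCycle_nil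
  | @cons _ x _ h p =>
    have hp := ((Walk.cons_isCycle_iff _ _).1 hc').1
    have key : ∀ a (ha : a ∈ ((Walk.cons h p).toSubgraph.deleteVerts {v}).verts),
        ∃ hx : x ∈ ((Walk.cons h p).toSubgraph.deleteVerts {v}).verts,
        ((Walk.cons h p).toSubgraph.deleteVerts {v}).coe.Reachable ⟨x, hx⟩ ⟨a, ha⟩ := by
      intro a ha
      have ha' := ha
      simp only [Subgraph.deleteVerts_verts, Walk.verts_toSubgraph, Set.mem_sdiff,
        Set.mem_ofPred_eq, Walk.support_cons, List.mem_cons, Set.mem_singleton_iff] at ha'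
      have hap : a ∈ p.support := by tauto
      have hv : v ∉ (p.takeUntil a hap).support :=
        Walk.endpoint_notMem_support_takeUntil hp hap (Ne.symm ha'.2)
      have hle : (p.takeUntil a hap).toSubgraph ≤
          (Walk.cons h p).toSubgraph.deleteVerts {v} := by
        have h1 : (p.takeUntil a hap).toSubgraph ≤ (Walk.cons h p).toSubgraph := by
          have h2 : p.toSubgraph = (p.takeUntil a hap).toSubgraph ⊔
              (p.dropUntil a hap).toSubgraph := by
            rw [← Walk.toSubgraph_append, Walk.take_spec]
          rw [Walk.toSubgraph, h2]
          exact le_sup_left.trans le_sup_right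
        refine ⟨fun y hy => ⟨h1.1 hy, ?_⟩, fun y z hyz => ?_⟩
        · rintro rfl
          exact hv (by simpa using hy)
        · rw [Subgraph.deleteVerts_adj]
          refine ⟨h1.1 hyz.fst_mem, ?_, h1.1 hyz.snd_mem, ?_, h1.2 hyz⟩
          · rintro rfl
            exact hv (by simpa using hyz.fst_mem)
          · rintro rfl
            exact hv (by simpa using hyz.snd_mem)
      have := (Walk.toSubgraph_connected (p.takeUntil a hap)).preconnected.coe
        ⟨x, by simp⟩ ⟨a, by simp⟩
      exact ⟨hle.1 (by simp), this.map (Subgraph.inclusion hle)⟩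
    refine ⟨fun a b => ?_⟩
    obtain ⟨_, ha⟩ := key a.1 a.2
    obtain ⟨_, hb⟩ := key b.1 b.2
    exact ha.symm.trans hb

theorem IsBlockGraph.isClique_support [Finite V] (hG : G.IsBlockGraph)
    {u : V} {c : G.Walk u u} (hc : c.IsCycle) : G.IsClique {v | v ∈ c.support} := by
  classical
  have := hG.isClique_of_isNonseparable hc.isNonseparable_toSubgraph
  rwa [Walk.verts_toSubgraph] at this

theorem IsBlockGraph.adj_of_adj_of_adj [Finite V] (hG : G.IsBlockGraph) {a b u v : V}
    (hab : a ≠ b) (huv : u ≠ v) (hau : G.Adj a u) (hbu : G.Adj b u) (hav : G.Adj a v)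
    (hbv : G.Adj b v) : G.Adj u v := by
  -- The 4-cycle `a, u, b, v`.
  have hc : (Walk.cons hau (Walk.cons hbu.symm (Walk.cons hbv
      (Walk.cons hav.symm Walk.nil)))).IsCycle := by
    simp [Walk.cons_isCycle_iff, Walk.cons_isPath_iff, hab, hab.symm, huv, hau.ne,
      hau.ne', hbu.ne', hav.ne, hav.ne', hbv.ne]
  exact hG.isClique_support hc (by simp) (by simp) huv

/-- In a block graph, two neighbors of `w` that are joined by a walk avoiding `w` are equal or
adjacent. -/
theorem IsBlockGraph.adj_of_walk [Finite V] (hG : G.IsBlockGraph) {a b w : V}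
    (hwa : G.Adj w a) (hwb : G.Adj w b) (hab : a ≠ b) (p : G.Walk a b) (hw : w ∉ p.support) :
    G.Adj a b := by
  classical
  have hw' : w ∉ p.bypass.support := fun h => hw (p.support_bypass_subset_support h)
  have hc : (Walk.cons hwa (p.bypass.concat hwb.symm)).IsCycle := by
    rw [Walk.cons_isCycle_iff]
    refine ⟨(p.bypass_isPath).concat hw' _, ?_⟩
    rw [Walk.edges_concat]
    simp only [List.concat_eq_append, List.mem_append, List.mem_singleton, not_or]
    exact ⟨fun h => hw' (Walk.fst_mem_support_of_mem_edges _ h), by simp [hab, hwb.ne]⟩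
  exact hG.isClique_support hc (by simp) (by simp) hab

/-- The ambient walk of a walk in an induced subgraph. -/
theorem exists_walk_of_reachable_induce {s : Set V} {x y : s} (h : (G.induce s).Reachable x y) :
    ∃ p : G.Walk x y, ∀ z ∈ p.support, z ∈ s := by
  obtain ⟨p⟩ := h
  refine ⟨p.map (Embedding.induce s).toHom, fun z hz => ?_⟩
  obtain ⟨z', _, rfl⟩ := List.mem_map.1 ((Walk.support_map (Embedding.induce s).toHom p) ▸ hz)
  exact z'.2

/-- Every vertex of a connected induced subgraph can be joined, inside the graph without `w`,
to a neighbor of `w`. -/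
theorem exists_adj_reachable_of_walk {s : Set V} {w : V} {x : V} (p : G.Walk x w)
    (hp : ∀ z ∈ p.support, z ∈ insert w s) (hx : x ∈ s) (hw : w ∉ s) :
    ∃ a : s, G.Adj w a ∧ (G.induce s).Reachable ⟨x, hx⟩ a := by
  induction p with
  | nil => exact absurd hx hw
  | @cons u v w h q ih =>
    by_cases hv : v = w
    · subst hv
      exact ⟨⟨u, hx⟩, h.symm, Reachable.refl _⟩
    · have hvs : v ∈ s := by
        rcases hp v (by simp) with h' | h'
        · exact absurd h' hv
        · exact h'
      obtain ⟨a, ha, har⟩ := ih (fun z hz => hp z (by simp [hz])) hvs hw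
      refine ⟨a, ha, Reachable.trans (Adj.reachable ?_) har⟩
      exact h

/-- A connected set of vertices of a block graph that is not a clique has a vertex `w` such that
no other vertex can replace `w` without losing connectedness. -/
theorem IsBlockGraph.exists_cut_vertex [Finite V] (hG : G.IsBlockGraph) {S : Set V}
    (hS : (G.induce S).Connected) (hSc : ¬ G.IsClique S) :
    ∃ w ∈ S, ∀ v, (G.induce (insert v (S \ {w}))).Connected → v = w := by
  have hns : ¬ ((⊤ : G.Subgraph).induce S).IsNonseparable := fun h =>
    hSc (by simpa using hG.isClique_of_isNonseparable h)
  have hcon : ((⊤ : G.Subgraph).induce S).Connected := by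
    rwa [Subgraph.connected_iff', ← induce_eq_coe_induce_top]
  simp only [Subgraph.IsNonseparable, hcon, true_and, not_forall] at hns
  obtain ⟨w, hwS, hw⟩ := hns
  rw [Subgraph.induce_verts] at hwS
  refine ⟨w, hwS, fun v hv => by_contra fun hvw => hw ?_⟩
  have hins : insert w (S \ {w}) = S := by simp [hwS]
  have hwn : w ∉ S \ {w} := by simp
  -- Each vertex of `S \ {w}` reaches a neighbor of `w` inside `S \ {w}`. Two such neighbors `a`,
  -- `b` are joined through `insert v (S \ {w})`, thus avoiding `w` as `v ≠ w`, so they are equal or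
  -- adjacent.
  have main : (G.induce (S \ {w})).Preconnected := by
    intro x y
    have nb : ∀ x : ↥(S \ {w}), ∃ a : ↥(S \ {w}), G.Adj w a ∧
        (G.induce (S \ {w})).Reachable x a := by
      intro x
      obtain ⟨p, hp⟩ := exists_walk_of_reachable_induce
        (hS.preconnected ⟨x, x.2.1⟩ ⟨w, hwS⟩)
      exact exists_adj_reachable_of_walk p (by simpa [hins] using hp) x.2 hwn
    obtain ⟨a, hwa, hxa⟩ := nb x
    obtain ⟨b, hwb, hyb⟩ := nb y
    refine hxa.trans (Reachable.trans ?_ hyb.symm)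
    by_cases hab : a = b
    · rw [hab]
    obtain ⟨p, hp⟩ := exists_walk_of_reachable_induce
        (hv.preconnected ⟨a, Or.inr a.2⟩ ⟨b, Or.inr b.2⟩)
    have hwp : w ∉ p.support := fun h => by
      rcases hp w h with h | h
      · exact hvw h.symm
      · exact h.2 rfl
    have := hG.adj_of_walk hwa hwb (fun h => hab (Subtype.ext h)) p hwp
    exact Adj.reachable (by simpa using this)
  have heq : ((⊤ : G.Subgraph).induce S).deleteVerts {w} =
      (⊤ : G.Subgraph).induce (S \ {w}) := by
    ext x y
    · simp
    · simp only [Subgraph.induce_verts, Subgraph.induce_adj,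
        Set.mem_sdiff]
      tauto
  rw [heq]
  exact preconnected_induce_iff.1 main

end SimpleGraph

/-! ### Chordality of the clutter of connected sets. -/

namespace UniformClutter

variable {V : Type*} {d : ℕ}

theorem mem_edges_deletion {C : UniformClutter V d} {σ e : Finset V} :
    e ∈ (C.deletion σ).edges ↔ e ∈ C.edges ∧ ¬ σ ⊆ e := Iff.rfl

theorem exists_insert_of_subset [DecidableEq V] {C : UniformClutter V d} {σ e : Finset V}
    (hσ : σ.card + 1 = d) (he : e ∈ C.edges) (hσe : σ ⊆ e) :
    ∃ v ∉ σ, e = insert v σ := by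
  have h1 := C.card_eq e he
  have h2 := Finset.card_sdiff_add_card_eq_card hσe
  obtain ⟨v, hv⟩ := Finset.card_eq_one.1 (show (e \ σ).card = 1 by lia)
  refine ⟨v, ?_, ?_⟩
  · have : v ∈ e \ σ := by simp [hv]
    exact (Finset.mem_sdiff.1 this).2
  · rw [← Finset.sdiff_union_of_subset hσe, hv, Finset.insert_eq]

theorem ncard_edges_deletion_lt [Finite V] {C : UniformClutter V d} {σ e : Finset V}
    (he : e ∈ C.edges) (hσe : σ ⊆ e) : (C.deletion σ).edges.ncard < C.edges.ncard := by
  refine Set.ncard_lt_ncard ⟨fun x hx => hx.1, fun h => ?_⟩ (Set.toFinite _)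
  exact (h he).2 hσe

theorem isMaximalSubedge_of_mem [DecidableEq V] {C : UniformClutter V d} {σ : Finset V} {v : V}
    (hσ : σ.card + 1 = d) (hv : v ∉ σ) (h : insert v σ ∈ C.edges) : C.IsMaximalSubedge σ := by
  refine ⟨hσ, fun heq => hv ?_⟩
  have : v ∈ C.closedNeighborhood σ := Or.inr h
  rw [heq] at this
  exact this

end UniformClutter

namespace SimpleGraph

variable {V : Type*} {G : SimpleGraph V} [DecidableEq V]

theorem IsClique.connected_induce {s : Set V} (hs : G.IsClique s) (hne : s.Nonempty) :
    (G.induce s).Connected := by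
  have : Nonempty s := hne.to_subtype
  refine (connected_iff _).2 ⟨fun x y => ?_, this⟩
  by_cases h : x = y
  · rw [h]
  · exact Adj.reachable (hs x.2 y.2 (fun h' => h (Subtype.ext h')))

/-- Two vertices of `N` outside `σ` are common neighbors of two distinct vertices of `σ`, so they
lie on a 4-cycle with them. This is where `2 ≤ r` matters. -/
theorem IsBlockGraph.isClique_union_neighbors [Finite V] (hG : G.IsBlockGraph) {σ : Finset V}
    (hσ : 2 ≤ σ.card) {N : Set V} (hN : ∀ v ∈ N, G.IsClique ((insert v σ : Finset V) : Set V))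
    (hN' : N.Nonempty) : G.IsClique ((σ : Set V) ∪ N) := by
  obtain ⟨a, ha, b, hb, hab⟩ := Finset.one_lt_card.1 (show 1 < σ.card by lia)
  have hadj : ∀ v ∈ N, ∀ c ∈ σ, v ≠ c → G.Adj c v := fun v hv c hc hvc =>
    hN v hv (by simp [hc]) (by simp) hvc.symm
  have hσc : G.IsClique (σ : Set V) := by
    obtain ⟨v, hv⟩ := hN'
    exact (hN v hv).subset (by simp)
  rintro x (hx | hx) y (hy | hy) hxy
  · exact hσc hx hy hxy
  · exact hadj y hy x hx hxy.symm
  · exact (hadj x hx y hy hxy).symm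
  · by_cases hxσ : x ∈ σ
    · exact hadj y hy x hxσ hxy.symm
    by_cases hyσ : y ∈ σ
    · exact (hadj x hx y hyσ hxy).symm
    have hne : ∀ {c z : V}, c ∈ σ → z ∉ σ → z ≠ c := by
      rintro c z hc hz rfl
      exact hz hc
    exact hG.adj_of_adj_of_adj hab hxy (hadj x hx a ha (hne ha hxσ)) (hadj x hx b hb (hne hb hxσ))
      (hadj y hy a ha (hne ha hyσ)) (hadj y hy b hb (hne hb hyσ))

theorem exists_insert_of_injective {ρ : V → ℕ} (hρ : Function.Injective ρ) {T : Finset V}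
    (hT : T.Nonempty) : ∃ v ∉ T.erase v, (∀ w ∈ T.erase v, ρ w < ρ v) ∧ insert v (T.erase v) = T ∧
      v ∈ T := by
  obtain ⟨v, hv, hmax⟩ := T.exists_max_image ρ hT
  refine ⟨v, by simp, fun w hw => ?_, Finset.insert_erase hv, hv⟩
  rw [Finset.mem_erase] at hw
  exact lt_of_le_of_ne (hmax w hw.2) (fun h => hw.1 (hρ h))

/-- A subclutter of the clutter of connected sets is chordal if the `(r + 1)`-cliques `insert v σ`
that belong to it, where `v` is the last vertex, are those with `σ` in an upper set of the preorder
that compares the last vertices. -/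
theorem IsBlockGraph.isChordal_of_upperSet [Finite V] (hG : G.IsBlockGraph) {ρ : V → ℕ}
    (hρ : Function.Injective ρ) {r : ℕ} (hr : 2 ≤ r) (n : ℕ) :
    ∀ (D : UniformClutter V (r + 1)) (A : Set (Finset V)), D.edges.ncard ≤ n →
      D.edges ⊆ (G.connectedClutter r).edges →
      (∀ σ v, σ.card = r → (∀ w ∈ σ, ρ w < ρ v) → G.IsClique ((insert v σ : Finset V) : Set V) →
        (insert v σ ∈ D.edges ↔ σ ∈ A)) →
      (∀ σ τ, σ ∈ A → σ.sup ρ < τ.sup ρ → τ ∈ A) → D.IsChordal := by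
  induction n with
  | zero =>
    intro D A hn _ _ _
    refine .empty D ?_
    rwa [Nat.le_zero, Set.ncard_eq_zero (Set.toFinite _)] at hn
  | succ n ih =>
    intro D A hn hD hA hup
    by_cases hcl : ∀ S ∈ D.edges, G.IsClique (S : Set V)
    · by_cases hE : D.edges = ∅
      · exact .empty D hE
      let P : Set (Finset V) := {σ | σ.card = r ∧ ∃ v, (∀ w ∈ σ, ρ w < ρ v) ∧ insert v σ ∈ D.edges}
      have hP : P.Nonempty := by
        obtain ⟨T, hT⟩ := Set.nonempty_iff_ne_empty.2 hE
        have hTc := D.card_eq T hT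
        obtain ⟨v, _, hlt, hins, hv⟩ := exists_insert_of_injective hρ
          (Finset.card_pos.1 (show 0 < T.card by lia))
        exact ⟨T.erase v, by rw [Finset.card_erase_of_mem hv, hTc]; rfl, v, hlt, by rwa [hins]⟩
      -- All edges are cliques now, and `P` consists of the edges with their last vertex removed.
      -- Since `σ.sup ρ` is the position of the last vertex of `σ`, the chosen `σ` ends as early as
      -- possible.
      obtain ⟨σ, hσP, hmin⟩ := P.toFinite.exists_minimalFor (fun σ => σ.sup ρ) P hP
      obtain ⟨hσc, v₀, hv₀, hv₀D⟩ := hσP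
      have hmin' : ∀ τ ∈ P, σ.sup ρ ≤ τ.sup ρ := fun τ hτ => by
        rcases le_total (σ.sup ρ) (τ.sup ρ) with h | h
        · exact h
        · exact hmin hτ h
      have hσA : σ ∈ A := (hA σ v₀ hσc hv₀ (hcl _ hv₀D)).1 hv₀D
      -- Otherwise the last vertex `u` of `insert v σ` lies in `σ`, and removing it leaves a member
      -- of `P` that ends before `u`, hence before `σ` does, against minimality.
      have hlt_of : ∀ v ∉ σ, insert v σ ∈ D.edges → ∀ w ∈ σ, ρ w < ρ v := by
        intro v hv hvD
        by_contra! hcon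
        obtain ⟨w, hw, hwv⟩ := hcon
        obtain ⟨u, hu, hult, huins, huT⟩ := exists_insert_of_injective hρ
          (Finset.insert_nonempty v σ)
        have huv : u ≠ v := by
          rintro rfl
          have := hult w (by
            rw [Finset.mem_erase]; exact ⟨fun h => hv (h ▸ hw), by simp [hw]⟩)
          lia
        have huσ : u ∈ σ := by simpa [huv] using huT
        have hτ : (insert v σ).erase u ∈ P := by
          refine ⟨?_, u, hult, by rwa [huins]⟩
          rw [Finset.card_erase_of_mem huT, D.card_eq _ hvD]; rfl
        have h1 := hmin' _ hτ
        have h2 : ((insert v σ).erase u).sup ρ < ρ u := by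
          -- The supremum of the empty set is `0`, so `0 < ρ u` has to be supplied as well.
          rw [Finset.sup_lt_iff]
          · exact hult
          · have := hult v (by simp [huv.symm])
            exact lt_of_le_of_lt (Nat.zero_le _) this
        have h3 : ρ u ≤ σ.sup ρ := Finset.le_sup huσ
        lia
      have hNlt : ∀ e : Finset V, (e : Set V) ⊆ D.closedNeighborhood σ → ∀ x ∈ e, x ∉ σ →
          ∀ w ∈ σ, ρ w < ρ x := by
        intro e he x hx hxσ
        refine hlt_of x hxσ ?_
        rcases he hx with h | h
        · exact absurd h hxσ
        · exact h
      have hNcl : G.IsClique (D.closedNeighborhood σ) :=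
        hG.isClique_union_neighbors (by lia) (fun v hv => hcl _ hv) ⟨v₀, hv₀D⟩
      have hv₀σ : v₀ ∉ σ := fun h => lt_irrefl _ (hv₀ v₀ h)
      refine .step D σ ⟨UniformClutter.isMaximalSubedge_of_mem (by rw [hσc]) hv₀σ hv₀D, ?_⟩ ?_
      · intro e he hec
        obtain ⟨v, hv, hlt, hins, hve⟩ := exists_insert_of_injective hρ
          (Finset.card_pos.1 (show 0 < e.card by lia))
        have hτc : (e.erase v).card = r := by rw [Finset.card_erase_of_mem hve, hec]; rfl
        rw [← hins]
        refine (hA _ v hτc hlt (by rw [hins]; exact hNcl.subset he)).2 ?_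
        -- If `e` without its last vertex is not `σ`, it has an element outside `σ`. That element
        -- comes after all of `σ`, so `e.erase v` ends later than `σ` and belongs to `A`.
        by_cases hτσ : e.erase v = σ
        · rwa [hτσ]
        refine hup σ _ hσA ?_
        obtain ⟨x, hx, hxσ⟩ : ∃ x ∈ e.erase v, x ∉ σ := by
          by_contra! hcon
          exact hτσ (Finset.eq_of_subset_of_card_le hcon (by lia))
        have hlt' := hNlt e he x (Finset.mem_of_mem_erase hx) hxσ
        have hpos : ∃ w, w ∈ σ := Finset.card_pos.1 (show 0 < σ.card by lia)
        obtain ⟨w, hw⟩ := hpos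
        refine lt_of_lt_of_le ?_ (Finset.le_sup hx : ρ x ≤ _)
        rw [Finset.sup_lt_iff]
        · exact hlt'
        · exact lt_of_le_of_lt (Nat.zero_le _) (hlt' w hw)
      -- Merely removing `σ` from `A` could destroy the upper set property, because of members that
      -- end earlier than `σ`. By minimality these give no edges, so they are dropped as well.
      · refine ih (D.deletion σ) {τ | τ ∈ A ∧ σ.sup ρ ≤ τ.sup ρ ∧ τ ≠ σ} ?_
          (fun e he => hD he.1) ?_ ?_
        · have := UniformClutter.ncard_edges_deletion_lt hv₀D (Finset.subset_insert v₀ σ)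
          lia
        · intro τ v hτc hlt hcl'
          rw [UniformClutter.mem_edges_deletion, hA τ v hτc hlt hcl']
          have hvτ : v ∉ τ := fun h => lt_irrefl _ (hlt v h)
          constructor
          · rintro ⟨h1, h2⟩
            refine ⟨h1, hmin' τ ⟨hτc, v, hlt, (hA τ v hτc hlt hcl').2 h1⟩, ?_⟩
            rintro rfl
            exact h2 (Finset.subset_insert v τ)
          · rintro ⟨h1, h2, h3⟩
            refine ⟨h1, fun hsub => h3 ?_⟩
            have hD' := (hA τ v hτc hlt hcl').2 h1
            -- An edge containing `σ` is `insert u σ` with `u` last, while `v` is last in `insert v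
            -- τ`; hence `u = v` and `τ = σ`.
            obtain ⟨u, hu, hueq⟩ := UniformClutter.exists_insert_of_subset (by rw [hσc]) hD' hsub
            have hu' := hlt_of u hu (hueq ▸ hD')
            have huv : u = v := by
              by_contra hne
              have hvσ : v ∈ σ := by
                have : v ∈ insert u σ := hueq ▸ Finset.mem_insert_self v τ
                simpa [Ne.symm hne] using this
              have huτ : u ∈ τ := by
                have : u ∈ insert v τ := hueq ▸ Finset.mem_insert_self u σ
                simpa [hne] using this
              have := hu' v hvσ
              have := hlt u huτ
              lia
            subst huv
            rw [← Finset.erase_insert hvτ, hueq, Finset.erase_insert hu]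
        · rintro τ τ' ⟨h1, h2, h3⟩ hlt
          refine ⟨hup τ τ' h1 hlt, by lia, ?_⟩
          rintro rfl
          lia
    · push Not at hcl
      obtain ⟨S, hSD, hSn⟩ := hcl
      obtain ⟨hSc, hScon⟩ := hD hSD
      obtain ⟨w, hwS, hw⟩ := hG.exists_cut_vertex hScon hSn
      have hwS : w ∈ S := hwS
      have hσc : (S.erase w).card = r := by rw [Finset.card_erase_of_mem hwS, hSc]; rfl
      have hins : insert w (S.erase w) = S := Finset.insert_erase hwS
      have huniq : ∀ v, insert v (S.erase w) ∈ D.edges → v = w := by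
        intro v hv
        refine hw v ?_
        have := (hD hv).2
        rwa [Finset.coe_insert, Finset.coe_erase] at this
      have hN : D.closedNeighborhood (S.erase w) = (S : Set V) := by
        ext x
        constructor
        · rintro (hx | hx)
          · exact Finset.mem_of_mem_erase hx
          · exact huniq x hx ▸ hwS
        · intro hx
          by_cases hxw : x = w
          · right
            subst hxw
            change insert x (S.erase x) ∈ D.edges
            rwa [hins]
          · left
            exact Finset.mem_coe.2 (Finset.mem_erase.2 ⟨hxw, hx⟩)
      have honly : ∀ e ∈ D.edges, S.erase w ⊆ e → e = S := by
        intro e he hsub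
        obtain ⟨u, hu, hueq⟩ := UniformClutter.exists_insert_of_subset (by rw [hσc]) he hsub
        rw [hueq, huniq u (hueq ▸ he), hins]
      -- The deletion removes only the non-clique `S`, so the condition on cliques persists with the
      -- same `A`.
      refine .step D (S.erase w)
        ⟨UniformClutter.isMaximalSubedge_of_mem (by rw [hσc]) (by simp) (hins.symm ▸ hSD), ?_⟩ ?_
      · intro e he hec
        rw [hN] at he
        have : e = S := Finset.eq_of_subset_of_card_le (by exact_mod_cast he) (by lia)
        rwa [this]
      · refine ih (D.deletion (S.erase w)) A ?_ (fun e he => hD he.1) ?_ hup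
        · have := UniformClutter.ncard_edges_deletion_lt hSD (Finset.erase_subset w S)
          lia
        · intro τ v hτc hlt hcl'
          rw [UniformClutter.mem_edges_deletion, ← hA τ v hτc hlt hcl']
          refine ⟨fun h => h.1, fun h => ⟨h, fun hsub => hSn ?_⟩⟩
          rw [← honly _ h hsub]
          exact hcl'

theorem IsBlockGraph.isChordal_connectedClutter [Finite V] (hG : G.IsBlockGraph) {r : ℕ}
    (hr : 2 ≤ r) : (G.connectedClutter r).IsChordal := by
  obtain ⟨n, ⟨f⟩⟩ := Finite.exists_equiv_fin V
  -- At the start every `(r + 1)`-clique is an edge, so `A` is everything.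
  refine hG.isChordal_of_upperSet (ρ := fun v => (f v : ℕ))
    (fun a b h => f.injective (Fin.ext h)) hr _ _ Set.univ le_rfl le_rfl ?_
    (fun _ _ _ _ => trivial)
  intro σ v hσ hlt hcl
  have hv : v ∉ σ := fun h => lt_irrefl _ (hlt v h)
  refine ⟨fun _ => trivial, fun _ => ⟨by rw [Finset.card_insert_of_notMem hv, hσ], ?_⟩⟩
  exact hcl.connected_induce ⟨v, by simp⟩

end SimpleGraph

/-! ### Modules with a linear resolution. -/

open TensorProduct

section LinearModules

universe v w

variable {K : Type v} [Field K] {A : Type w} [CommRing A] [Algebra K A]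

section Cover

variable {M N : Type*} [AddCommGroup M] [Module K M] [Module A M] [IsScalarTower K A M]
  [AddCommGroup N] [Module K N] [Module A N] [IsScalarTower K A N]

/-- The canonical map `A ⊗ W → M` for a subspace `W` of an `A`-module `M`. -/
noncomputable def Submodule.cover (A : Type w) [CommRing A] [Algebra K A] [Module A M]
    [IsScalarTower K A M] (W : Submodule K M) : A ⊗[K] W →ₗ[A] M :=
  LinearMap.liftBaseChange A W.subtype

@[simp]
theorem Submodule.cover_tmul (W : Submodule K M) (a : A) (x : W) :
    W.cover A (a ⊗ₜ[K] x) = a • (x : M) := by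
  simp [Submodule.cover]

theorem Submodule.range_cover (W : Submodule K M) :
    LinearMap.range (W.cover A) = Submodule.span A (W : Set M) := by
  apply le_antisymm
  · rintro _ ⟨t, rfl⟩
    induction t with
    | zero => simp
    | add x y hx hy => rw [map_add]; exact add_mem hx hy
    | tmul a x =>
      rw [Submodule.cover_tmul]
      exact Submodule.smul_mem _ _ (Submodule.subset_span x.2)
  · rw [Submodule.span_le]
    intro x hx
    exact ⟨1 ⊗ₜ[K] (⟨x, hx⟩ : W), by simp⟩

theorem Submodule.cover_surjective {W : Submodule K M} (h : Submodule.span A (W : Set M) = ⊤) :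
    Function.Surjective (W.cover A) := by
  rw [← LinearMap.range_eq_top, Submodule.range_cover, h]

/-- The map of covers induced by a linear map. -/
noncomputable def LinearMap.coverMap (f : M →ₗ[A] N) {W : Submodule K M} {W' : Submodule K N}
    (h : ∀ x ∈ W, f x ∈ W') : A ⊗[K] W →ₗ[A] A ⊗[K] W' :=
  LinearMap.baseChange A ((f.restrictScalars K).restrict h)

theorem LinearMap.coverMap_tmul (f : M →ₗ[A] N) {W : Submodule K M} {W' : Submodule K N}
    (h : ∀ x ∈ W, f x ∈ W') (a : A) (x : W) :
    f.coverMap h (a ⊗ₜ[K] x) = a ⊗ₜ[K] (⟨f x, h x x.2⟩ : W') := by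
  rfl

theorem LinearMap.cover_coverMap (f : M →ₗ[A] N) {W : Submodule K M} {W' : Submodule K N}
    (h : ∀ x ∈ W, f x ∈ W') (t : A ⊗[K] W) :
    W'.cover A (f.coverMap h t) = f (W.cover A t) := by
  induction t with
  | zero => simp
  | add x y hx hy => simp only [map_add, hx, hy]
  | tmul a x => simp [LinearMap.coverMap_tmul]

theorem LinearMap.coverMap_injective {f : M →ₗ[A] N} (hf : Function.Injective f)
    {W : Submodule K M} {W' : Submodule K N} (h : ∀ x ∈ W, f x ∈ W') :
    Function.Injective (f.coverMap h) := by
  rw [LinearMap.coverMap, LinearMap.baseChange_eq_ltensor]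
  refine Module.Flat.lTensor_preserves_injective_linearMap _ fun x y hxy => ?_
  exact Subtype.ext (hf (congrArg Subtype.val hxy))

theorem LinearMap.coverMap_surjective {f : M →ₗ[A] N} {W : Submodule K M} {W' : Submodule K N}
    (h : ∀ x ∈ W, f x ∈ W') (h' : ∀ y ∈ W', ∃ x ∈ W, f x = y) :
    Function.Surjective (f.coverMap h) := by
  rw [LinearMap.coverMap, LinearMap.baseChange_eq_ltensor]
  refine LinearMap.lTensor_surjective _ fun y => ?_
  obtain ⟨x, hx, hxy⟩ := h' y y.2
  exact ⟨⟨x, hx⟩, Subtype.ext hxy⟩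

end Cover

variable (𝒜 : ℕ → Submodule K A) [GradedAlgebra 𝒜]

/-- A family of projections of an `A`-module that defines a grading compatible with that
of `A`. -/
structure IsGradingFamily {Q : Type*} [AddCommGroup Q] [Module K Q] [Module A Q]
    (π : ℕ → Q →ₗ[K] Q) : Prop where
  idem : ∀ n q, π n (π n q) = π n q
  smul : ∀ n k a q, π k q = q → π (n + k) (a • q) = GradedAlgebra.proj 𝒜 n a • q

theorem proj_mul_proj (n k : ℕ) (a b : A) :
    GradedAlgebra.proj 𝒜 (n + k) (a * GradedAlgebra.proj 𝒜 k b) =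
      GradedAlgebra.proj 𝒜 n a * GradedAlgebra.proj 𝒜 k b := by
  simp only [GradedAlgebra.proj_apply]
  exact DirectSum.coe_decompose_mul_add_of_right_mem 𝒜 (SetLike.coe_mem _)

theorem proj_proj (n : ℕ) (a : A) :
    GradedAlgebra.proj 𝒜 n (GradedAlgebra.proj 𝒜 n a) = GradedAlgebra.proj 𝒜 n a := by
  simp only [GradedAlgebra.proj_apply]
  exact DirectSum.decompose_of_mem_same 𝒜 (SetLike.coe_mem _)

theorem isGradingFamily_proj : IsGradingFamily 𝒜 (GradedAlgebra.proj 𝒜) where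
  idem := proj_proj 𝒜
  smul n k a q hq := by
    rw [← hq, smul_eq_mul, proj_mul_proj, smul_eq_mul]

/-- The projection of `A ⊗ W` to its component of degree `n`, the elements of `W` being of
degree `0`. -/
noncomputable def tensorProj (n : ℕ) (W : Type*) [AddCommGroup W] [Module K W] :
    A ⊗[K] W →ₗ[K] A ⊗[K] W :=
  LinearMap.rTensor W (GradedAlgebra.proj 𝒜 n)

@[simp]
theorem tensorProj_tmul (n : ℕ) {W : Type*} [AddCommGroup W] [Module K W] (a : A) (x : W) :
    tensorProj 𝒜 n W (a ⊗ₜ[K] x) = GradedAlgebra.proj 𝒜 n a ⊗ₜ[K] x := by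
  simp [tensorProj]

theorem isGradingFamily_tensorProj (W : Type*) [AddCommGroup W] [Module K W] :
    IsGradingFamily 𝒜 (fun n => tensorProj 𝒜 n W) where
  idem n q := by
    induction q with
    | zero => simp
    | add x y hx hy => simp only [map_add, hx, hy]
    | tmul a x => simp only [tensorProj_tmul, proj_proj]
  smul n k a q hq := by
    rw [← hq]
    clear hq
    induction q with
    | zero => simp
    | add x y hx hy => simp only [map_add, smul_add, hx, hy]
    | tmul b x => simp only [tensorProj_tmul, smul_tmul', smul_eq_mul, proj_mul_proj]

theorem IsGradingFamily.prod {Q Q' : Type*} [AddCommGroup Q] [Module K Q] [Module A Q]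
    [AddCommGroup Q'] [Module K Q'] [Module A Q'] {π : ℕ → Q →ₗ[K] Q} {π' : ℕ → Q' →ₗ[K] Q'}
    (h : IsGradingFamily 𝒜 π) (h' : IsGradingFamily 𝒜 π') :
    IsGradingFamily 𝒜 (fun n => (π n).prodMap (π' n)) where
  idem n q := Prod.ext (h.idem n q.1) (h'.idem n q.2)
  smul n k a q hq := Prod.ext (h.smul n k a q.1 (congrArg Prod.fst hq))
    (h'.smul n k a q.2 (congrArg Prod.snd hq))

theorem tensorProj_coverMap {M N : Type*} [AddCommGroup M] [Module K M] [Module A M]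
    [IsScalarTower K A M] [AddCommGroup N] [Module K N] [Module A N] [IsScalarTower K A N]
    (f : M →ₗ[A] N) {W : Submodule K M} {W' : Submodule K N} (h : ∀ x ∈ W, f x ∈ W') (n : ℕ)
    (t : A ⊗[K] W) : tensorProj 𝒜 n W' (f.coverMap h t) = f.coverMap h (tensorProj 𝒜 n W t) := by
  induction t with
  | zero => simp
  | add x y hx hy => simp only [map_add, hx, hy]
  | tmul a x => simp [LinearMap.coverMap_tmul]

section Piece

variable {Q : Type*} [AddCommGroup Q] [Module K Q] [Module A Q] [IsScalarTower K A Q]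

/-- The subspace of a submodule `S` of `Q` that is fixed by a projection of `Q`. -/
def Submodule.piece (S : Submodule A Q) (π : Q →ₗ[K] Q) : Submodule K S where
  carrier := {s | π s = s}
  add_mem' := by
    intro a b ha hb
    simp only [Set.mem_ofPred_eq] at *
    simp [ha, hb]
  zero_mem' := by simp
  smul_mem' := by
    intro c x hx
    simp only [Set.mem_ofPred_eq] at *
    simp [hx]

theorem Submodule.mem_piece {S : Submodule A Q} {π : Q →ₗ[K] Q} {s : S} :
    s ∈ S.piece π ↔ π s = s := Iff.rfl

variable {𝒜}

theorem IsGradingFamily.cover_tensorProj {π : ℕ → Q →ₗ[K] Q} (hπ : IsGradingFamily 𝒜 π)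
    (S : Submodule A Q) (n k : ℕ) (t : A ⊗[K] S.piece (π k)) :
    π (n + k) ((S.piece (π k)).cover A t : S) =
      ((S.piece (π k)).cover A (tensorProj 𝒜 n _ t) : S) := by
  induction t with
  | zero => simp
  | add x y hx hy => simp only [map_add, Submodule.coe_add, hx, hy]
  | tmul a x =>
    simp only [tensorProj_tmul, Submodule.cover_tmul, Submodule.coe_smul]
    exact hπ.smul n k a _ x.2

/-- Project any preimage to its component of degree `n`. This supplies the condition `hlin` of
`IsLinearModule.of_exact`. -/
theorem IsGradingFamily.exists_cover_eq {π : ℕ → Q →ₗ[K] Q} (hπ : IsGradingFamily 𝒜 π)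
    {S : Submodule A Q} {k : ℕ} (hS : Submodule.span A (S.piece (π k) : Set S) = ⊤) (n : ℕ)
    (s : S) (hs : π (n + k) s = s) :
    ∃ t, tensorProj 𝒜 n _ t = t ∧ (S.piece (π k)).cover A t = s := by
  obtain ⟨t, rfl⟩ := Submodule.cover_surjective hS s
  refine ⟨tensorProj 𝒜 n _ t, (isGradingFamily_tensorProj 𝒜 _).idem n t, Subtype.ext ?_⟩
  rw [← hπ.cover_tensorProj, hs]

theorem IsGradingFamily.cover_fixed {π : ℕ → Q →ₗ[K] Q} (hπ : IsGradingFamily 𝒜 π)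
    (S : Submodule A Q) {n k : ℕ} {t : A ⊗[K] S.piece (π k)} (ht : tensorProj 𝒜 n _ t = t) :
    π (n + k) ((S.piece (π k)).cover A t : S) = ((S.piece (π k)).cover A t : S) := by
  rw [hπ.cover_tensorProj, ht]

end Piece

/-- `IsLinearModule 𝒜 p M W` says that the `A`-module `M` is generated by the subspace `W`, that
the kernel of `A ⊗ W → M` is generated by its linear elements, and so on, and that after `p` steps
nothing is left: `M` has a linear resolution of length less than `p` with generators `W`. -/
def IsLinearModule : ℕ → ∀ (M : Type w) [AddCommGroup M] [Module K M] [Module A M]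
    [IsScalarTower K A M], Submodule K M → Prop
  | 0, M, _, _, _, _, _ => Subsingleton M
  | p + 1, M, _, _, _, _, W => Submodule.span A (W : Set M) = ⊤ ∧
      IsLinearModule p (LinearMap.ker (W.cover A))
        ((LinearMap.ker (W.cover A)).piece (tensorProj 𝒜 1 W))

namespace IsLinearModule

variable {𝒜}
variable {M N P : Type w} [AddCommGroup M] [Module K M] [Module A M] [IsScalarTower K A M]
  [AddCommGroup N] [Module K N] [Module A N] [IsScalarTower K A N]
  [AddCommGroup P] [Module K P] [Module A P] [IsScalarTower K A P]

theorem span_eq_top {p : ℕ} {W : Submodule K M} (h : IsLinearModule 𝒜 p M W) :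
    Submodule.span A (W : Set M) = ⊤ := by
  cases p with
  | zero =>
    have : Subsingleton M := h
    exact Subsingleton.elim _ _
  | succ p => exact h.1

theorem of_subsingleton [Subsingleton M] (p : ℕ) (W : Submodule K M) :
    IsLinearModule 𝒜 p M W := by
  induction p generalizing M with
  | zero => assumption
  | succ p ih =>
    refine ⟨Subsingleton.elim _ _, ?_⟩
    have : Subsingleton (A ⊗[K] W) := by
      refine ⟨fun x y => ?_⟩
      have h0 : ∀ x : A ⊗[K] W, x = 0 := by
        intro x
        induction x with
        | zero => rfl
        | add x y hx hy => rw [hx, hy, add_zero]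
        | tmul a x => rw [Subsingleton.elim x 0, tmul_zero]
      rw [h0 x, h0 y]
    exact ih _

theorem mono {p q : ℕ} (hpq : p ≤ q) {W : Submodule K M} (h : IsLinearModule 𝒜 p M W) :
    IsLinearModule 𝒜 q M W := by
  induction p generalizing M q with
  | zero =>
    have : Subsingleton M := h
    exact of_subsingleton _ _
  | succ p ih =>
    obtain ⟨q, rfl⟩ : ∃ q', q = q' + 1 := ⟨q - 1, by lia⟩
    exact ⟨h.1, ih (by lia) h.2⟩

/-- A retract of a linear module is linear. -/
theorem of_retract {p : ℕ} {W : Submodule K M} {W' : Submodule K N} (i : N →ₗ[A] M)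
    (r : M →ₗ[A] N) (hri : ∀ x, r (i x) = x) (hi : ∀ x ∈ W', i x ∈ W) (hr : ∀ x ∈ W, r x ∈ W')
    (h : IsLinearModule 𝒜 p M W) : IsLinearModule 𝒜 p N W' := by
  induction p generalizing M N with
  | zero =>
    have : Subsingleton M := h
    exact (show Function.Injective i from Function.LeftInverse.injective hri).subsingleton
  | succ p ih =>
    refine ⟨?_, ?_⟩
    · rw [← Submodule.range_cover, LinearMap.range_eq_top]
      intro x
      obtain ⟨t, ht⟩ := Submodule.cover_surjective h.1 (i x)
      exact ⟨r.coverMap hr t, by rw [LinearMap.cover_coverMap, ht, hri]⟩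
    · have hi' : ∀ t ∈ LinearMap.ker (W'.cover A), i.coverMap hi t ∈ LinearMap.ker (W.cover A) := by
        intro t ht
        rw [LinearMap.mem_ker] at ht ⊢
        rw [LinearMap.cover_coverMap, ht, map_zero]
      have hr' : ∀ t ∈ LinearMap.ker (W.cover A), r.coverMap hr t ∈ LinearMap.ker (W'.cover A) := by
        intro t ht
        rw [LinearMap.mem_ker] at ht ⊢
        rw [LinearMap.cover_coverMap, ht, map_zero]
      refine ih ((i.coverMap hi).restrict hi') ((r.coverMap hr).restrict hr') ?_ ?_ ?_ h.2
      · rintro ⟨t, ht⟩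
        apply Subtype.ext
        change r.coverMap hr (i.coverMap hi t) = t
        clear ht
        induction t with
        | zero => simp
        | add x y hx hy => simp only [map_add, hx, hy]
        | tmul a x => simp [LinearMap.coverMap_tmul, hri]
      · rintro ⟨t, ht⟩ htp
        rw [Submodule.mem_piece] at htp ⊢
        change tensorProj 𝒜 1 W (i.coverMap hi t) = i.coverMap hi t
        rw [tensorProj_coverMap]
        exact congrArg _ htp
      · rintro ⟨t, ht⟩ htp
        rw [Submodule.mem_piece] at htp ⊢
        change tensorProj 𝒜 1 W' (r.coverMap hr t) = r.coverMap hr t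
        rw [tensorProj_coverMap]
        exact congrArg _ htp

/-- An extension of linear modules is linear. -/
theorem of_exact {p : ℕ} {W : Submodule K M} {W' : Submodule K N} {W'' : Submodule K P}
    (f : N →ₗ[A] M) (g : M →ₗ[A] P) (hf : Function.Injective f) (hg : Function.Surjective g)
    (hfg : Function.Exact f g) (hfW : ∀ x, f x ∈ W ↔ x ∈ W') (hgW : ∀ x ∈ W, g x ∈ W'')
    (hgW' : ∀ y ∈ W'', ∃ x ∈ W, g x = y)
    (hlin : ∀ t, tensorProj 𝒜 1 W t = t → g (W.cover A t) = 0 →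
      ∃ t', tensorProj 𝒜 1 W' t' = t' ∧ f (W'.cover A t') = W.cover A t)
    (hN : IsLinearModule 𝒜 p N W') (hP : IsLinearModule 𝒜 p P W'') :
    IsLinearModule 𝒜 p M W := by
  induction p generalizing M N P with
  | zero =>
    have hN : Subsingleton N := hN
    have hP : Subsingleton P := hP
    change Subsingleton M
    have h0 : ∀ x : M, x = 0 := fun x => by
      obtain ⟨y, rfl⟩ := (hfg x).1 (Subsingleton.elim _ _)
      rw [Subsingleton.elim y 0, map_zero]
    exact ⟨fun x y => by rw [h0 x, h0 y]⟩
  | succ p ih =>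
    have hfW' : ∀ x ∈ W', f x ∈ W := fun x hx => (hfW x).2 hx
    have hsN := Submodule.cover_surjective hN.1
    have hsP := Submodule.cover_surjective hP.1
    have hcov : Function.Surjective (g.coverMap hgW) := LinearMap.coverMap_surjective hgW hgW'
    have hinj : Function.Injective (f.coverMap hfW') := LinearMap.coverMap_injective hf hfW'
    have hex : Function.Exact (f.coverMap hfW') (g.coverMap hgW) := by
      rw [LinearMap.coverMap, LinearMap.coverMap, LinearMap.baseChange_eq_ltensor,
        LinearMap.baseChange_eq_ltensor]
      refine Module.Flat.lTensor_exact A fun x => ?_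
      constructor
      · intro hx
        obtain ⟨y, hy⟩ := (hfg (x : M)).1 (congrArg Subtype.val hx)
        exact ⟨⟨y, (hfW y).1 (by rw [hy]; exact x.2)⟩, Subtype.ext hy⟩
      · rintro ⟨y, rfl⟩
        exact Subtype.ext (hfg.apply_apply_eq_zero y)
    have lift : ∀ t, g (W.cover A t) = 0 → ∃ t', f (W'.cover A t') = W.cover A t := by
      intro t ht
      obtain ⟨y, hy⟩ := (hfg _).1 ht
      obtain ⟨t', rfl⟩ := hsN y
      exact ⟨t', hy⟩
    refine ⟨?_, ?_⟩
    · rw [← Submodule.range_cover, LinearMap.range_eq_top]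
      intro x
      obtain ⟨t, ht⟩ := hsP (g x)
      obtain ⟨t, rfl⟩ := hcov t
      rw [LinearMap.cover_coverMap] at ht
      obtain ⟨y, hy⟩ := (hfg (x - W.cover A t)).1 (by rw [map_sub, ht, sub_self])
      obtain ⟨t', rfl⟩ := hsN y
      refine ⟨f.coverMap hfW' t' + t, ?_⟩
      rw [map_add, LinearMap.cover_coverMap, hy, sub_add_cancel]
    · have hf' : ∀ t ∈ LinearMap.ker (W'.cover A),
          f.coverMap hfW' t ∈ LinearMap.ker (W.cover A) := by
        intro t ht
        rw [LinearMap.mem_ker] at ht ⊢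
        rw [LinearMap.cover_coverMap, ht, map_zero]
      have hg' : ∀ t ∈ LinearMap.ker (W.cover A),
          g.coverMap hgW t ∈ LinearMap.ker (W''.cover A) := by
        intro t ht
        rw [LinearMap.mem_ker] at ht ⊢
        rw [LinearMap.cover_coverMap, ht, map_zero]
      have hex' : Function.Exact ((f.coverMap hfW').restrict hf')
          ((g.coverMap hgW).restrict hg') := by
        rintro ⟨t, ht⟩
        constructor
        · intro h0
          obtain ⟨t', rfl⟩ := (hex t).1 (congrArg Subtype.val h0)
          refine ⟨⟨t', ?_⟩, rfl⟩
          rw [LinearMap.mem_ker, LinearMap.cover_coverMap] at ht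
          exact hf (by rw [ht, map_zero])
        · rintro ⟨t', h'⟩
          rw [← h']
          exact Subtype.ext (hex.apply_apply_eq_zero _)
      -- The kernels of the three covers form a short exact sequence again, and the induction
      -- hypothesis applies to it.
      refine ih ((f.coverMap hfW').restrict hf') ((g.coverMap hgW).restrict hg') ?_ ?_ hex'
        ?_ ?_ ?_ ?_ hN.2 hP.2
      · intro x y hxy
        exact Subtype.ext (hinj (congrArg Subtype.val hxy))
      -- As in the snake lemma: a lift `t` of `s` need not lie in the kernel, but its image in `M`
      -- comes from `N`, and subtracting a preimage in `A ⊗ W'` corrects it.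
      · rintro ⟨s, hs⟩
        obtain ⟨t, rfl⟩ := hcov s
        rw [LinearMap.mem_ker, LinearMap.cover_coverMap] at hs
        obtain ⟨t', ht'⟩ := lift t hs
        refine ⟨⟨t - f.coverMap hfW' t', ?_⟩, Subtype.ext ?_⟩
        · rw [LinearMap.mem_ker, map_sub, LinearMap.cover_coverMap, ht', sub_self]
        · change g.coverMap hgW (t - f.coverMap hfW' t') = g.coverMap hgW t
          rw [map_sub, hex.apply_apply_eq_zero, sub_zero]
      · rintro ⟨t, ht⟩
        rw [Submodule.mem_piece, Submodule.mem_piece]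
        change tensorProj 𝒜 1 W (f.coverMap hfW' t) = f.coverMap hfW' t ↔ tensorProj 𝒜 1 W' t = t
        rw [tensorProj_coverMap, hinj.eq_iff]
      · rintro ⟨t, ht⟩ htp
        rw [Submodule.mem_piece] at htp ⊢
        change tensorProj 𝒜 1 W'' (g.coverMap hgW t) = g.coverMap hgW t
        rw [tensorProj_coverMap]
        exact congrArg _ htp
      · rintro ⟨s, hs⟩ hsp
        rw [Submodule.mem_piece] at hsp
        change tensorProj 𝒜 1 W'' s = s at hsp
        obtain ⟨t, rfl⟩ := hcov s
        rw [tensorProj_coverMap] at hsp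
        rw [LinearMap.mem_ker, ← hsp, LinearMap.cover_coverMap] at hs
        -- For a linear `s` the correction must be linear too, which is what `hlin` grants.
        obtain ⟨t', ht', htt'⟩ := hlin _ ((isGradingFamily_tensorProj 𝒜 W).idem 1 t) hs
        refine ⟨⟨tensorProj 𝒜 1 W t - f.coverMap hfW' t', ?_⟩, ?_, Subtype.ext ?_⟩
        · rw [LinearMap.mem_ker, map_sub, LinearMap.cover_coverMap, htt', sub_self]
        · rw [Submodule.mem_piece]
          change tensorProj 𝒜 1 W (tensorProj 𝒜 1 W t - f.coverMap hfW' t') = _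
          rw [map_sub, tensorProj_coverMap, ht', (isGradingFamily_tensorProj 𝒜 W).idem]
        · change g.coverMap hgW (tensorProj 𝒜 1 W t - f.coverMap hfW' t') = g.coverMap hgW t
          rw [map_sub, hex.apply_apply_eq_zero, sub_zero, hsp]
      -- The condition `hlin` for the kernels: the element has degree `1 + 1` and comes from the
      -- kernel over `N`, which is generated in degree `1`.
      · intro t ht h0
        obtain ⟨a, ha⟩ := (hex' _).1 h0
        have hfix := (isGradingFamily_tensorProj 𝒜 W).cover_fixed _ ht
        rw [← ha] at hfix
        have hfa : tensorProj 𝒜 (1 + 1) W' a = a := by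
          apply hinj
          rw [← tensorProj_coverMap]
          exact hfix
        obtain ⟨t', ht', hta⟩ := (isGradingFamily_tensorProj 𝒜 W').exists_cover_eq
          hN.2.span_eq_top 1 a hfa
        exact ⟨t', ht', by rw [hta, ha]⟩

/-- The quotient of a linear module by a linear module that is generated one degree higher is
linear. -/
theorem of_cokernel {p : ℕ} {W : Submodule K M} {W' : Submodule K N} {W'' : Submodule K P}
    (f : N →ₗ[A] M) (g : M →ₗ[A] P) (hf : Function.Injective f) (hg : Function.Surjective g)
    (hfg : Function.Exact f g) (hgW : ∀ x ∈ W, g x ∈ W'') (hgW' : ∀ y ∈ W'', ∃ x ∈ W, g x = y)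
    (hgi : ∀ x ∈ W, g x = 0 → x = 0)
    (hfW : ∀ x, x ∈ W' ↔ ∃ t, tensorProj 𝒜 1 W t = t ∧ W.cover A t = f x)
    (hN : IsLinearModule 𝒜 p N W') (hM : IsLinearModule 𝒜 (p + 1) M W) :
    IsLinearModule 𝒜 (p + 1) P W'' := by
  have hsM := Submodule.cover_surjective hM.1
  have hsurj : Function.Surjective (g.coverMap hgW) := LinearMap.coverMap_surjective hgW hgW'
  have hinj : Function.Injective (g.coverMap hgW) := by
    rw [LinearMap.coverMap, LinearMap.baseChange_eq_ltensor]
    refine Module.Flat.lTensor_preserves_injective_linearMap _ ?_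
    rw [injective_iff_map_eq_zero]
    intro x hx
    exact Subtype.ext (hgi x x.2 (congrArg Subtype.val hx))
  refine ⟨?_, ?_⟩
  · rw [← Submodule.range_cover, LinearMap.range_eq_top]
    intro y
    obtain ⟨x, rfl⟩ := hg y
    obtain ⟨t, rfl⟩ := hsM x
    exact ⟨g.coverMap hgW t, LinearMap.cover_coverMap _ _ _⟩
  have hg' : ∀ t ∈ LinearMap.ker (W.cover A),
      g.coverMap hgW t ∈ LinearMap.ker (W''.cover A) := by
    intro t ht
    rw [LinearMap.mem_ker] at ht ⊢
    rw [LinearMap.cover_coverMap, ht, map_zero]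
  have hker : ∀ {t}, g.coverMap hgW t ∈ LinearMap.ker (W''.cover A) → g (W.cover A t) = 0 := by
    intro t ht
    rwa [LinearMap.mem_ker, LinearMap.cover_coverMap] at ht
  -- As `g` is injective on `W`, the modules `M` and `P` have the same cover. An element of it dies
  -- in `P` exactly when its image in `M` lies in `N`; this defines the map `h` onto `N`, whose
  -- kernel is the kernel over `M`. Thus the kernel over `P` is an extension of linear modules.
  let e := LinearEquiv.ofBijective (g.coverMap hgW) ⟨hinj, hsurj⟩
  have he : ∀ t, e.symm (g.coverMap hgW t) = t := fun t => e.symm_apply_apply t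
  obtain ⟨h, hh⟩ : ∃ h : LinearMap.ker (W''.cover A) →ₗ[A] N, ∀ t ht,
      f (h ⟨g.coverMap hgW t, ht⟩) = W.cover A t := by
    let h₀ : LinearMap.ker (W''.cover A) →ₗ[A] M :=
      W.cover A ∘ₗ e.symm.toLinearMap ∘ₗ (LinearMap.ker (W''.cover A)).subtype
    have h₀v : ∀ t ht, h₀ ⟨g.coverMap hgW t, ht⟩ = W.cover A t := fun t ht =>
      congrArg (W.cover A) (he t)
    have hmem : ∀ s, h₀ s ∈ LinearMap.range f := by
      rintro ⟨s, hs⟩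
      obtain ⟨t, rfl⟩ := hsurj s
      rw [h₀v]
      exact (hfg _).1 (hker hs)
    refine ⟨(LinearEquiv.ofInjective f hf).symm.toLinearMap ∘ₗ
      h₀.codRestrict (LinearMap.range f) hmem, fun t ht => ?_⟩
    rw [← h₀v t ht]
    exact congrArg Subtype.val ((LinearEquiv.ofInjective f hf).apply_symm_apply
      (h₀.codRestrict (LinearMap.range f) hmem ⟨g.coverMap hgW t, ht⟩))
  have hex : Function.Exact ((g.coverMap hgW).restrict hg') h := by
    rintro ⟨s, hs⟩
    obtain ⟨t, rfl⟩ := hsurj s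
    constructor
    · intro h0
      have := hh t hs
      rw [h0, map_zero] at this
      exact ⟨⟨t, this.symm⟩, rfl⟩
    · rintro ⟨⟨t', ht'⟩, heq⟩
      have htt : t' = t := hinj (congrArg Subtype.val heq)
      subst htt
      apply hf
      rw [hh, map_zero]
      exact ht'
  refine of_exact ((g.coverMap hgW).restrict hg') h ?_ ?_ hex ?_ ?_ ?_ ?_ hM.2 hN
  · intro x y hxy
    exact Subtype.ext (hinj (congrArg Subtype.val hxy))
  · intro y
    obtain ⟨t, ht⟩ := hsM (f y)
    have hk : g.coverMap hgW t ∈ LinearMap.ker (W''.cover A) := by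
      rw [LinearMap.mem_ker, LinearMap.cover_coverMap, ht, hfg.apply_apply_eq_zero]
    exact ⟨⟨_, hk⟩, hf (by rw [hh, ht])⟩
  · rintro ⟨t, ht⟩
    rw [Submodule.mem_piece, Submodule.mem_piece]
    change tensorProj 𝒜 1 W'' (g.coverMap hgW t) = g.coverMap hgW t ↔ tensorProj 𝒜 1 W t = t
    rw [tensorProj_coverMap, hinj.eq_iff]
  · rintro ⟨s, hs⟩ hsp
    obtain ⟨t, rfl⟩ := hsurj s
    rw [Submodule.mem_piece] at hsp
    change tensorProj 𝒜 1 W'' (g.coverMap hgW t) = g.coverMap hgW t at hsp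
    rw [tensorProj_coverMap, hinj.eq_iff] at hsp
    exact (hfW _).2 ⟨t, hsp, (hh t hs).symm⟩
  · intro y hy
    obtain ⟨t, htp, ht⟩ := (hfW y).1 hy
    have hk : g.coverMap hgW t ∈ LinearMap.ker (W''.cover A) := by
      rw [LinearMap.mem_ker, LinearMap.cover_coverMap, ht, hfg.apply_apply_eq_zero]
    refine ⟨⟨_, hk⟩, ?_, hf (by rw [hh, ht])⟩
    rw [Submodule.mem_piece]
    change tensorProj 𝒜 1 W'' (g.coverMap hgW t) = g.coverMap hgW t
    rw [tensorProj_coverMap, htp]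
  · intro t ht h0
    obtain ⟨a, ha⟩ := (hex _).1 h0
    have hfix := (isGradingFamily_tensorProj 𝒜 W'').cover_fixed _ ht
    rw [← ha] at hfix
    have hfa : tensorProj 𝒜 (1 + 1) W a = a := by
      apply hinj
      rw [← tensorProj_coverMap]
      exact hfix
    obtain ⟨t', ht', hta⟩ := (isGradingFamily_tensorProj 𝒜 W).exists_cover_eq
      hM.2.span_eq_top 1 a hfa
    exact ⟨t', ht', by rw [hta, ha]⟩

/-- Linearity is invariant under isomorphism. -/
theorem of_equiv {p : ℕ} {W : Submodule K M} {W' : Submodule K N} (e : M ≃ₗ[A] N)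
    (he : ∀ x, e x ∈ W' ↔ x ∈ W) (h : IsLinearModule 𝒜 p M W) : IsLinearModule 𝒜 p N W' :=
  of_retract e.symm.toLinearMap e.toLinearMap (fun x => e.apply_symm_apply x)
    (fun x hx => (he _).1 (by rwa [← e.apply_symm_apply x] at hx)) (fun x hx => (he x).2 hx) h

end IsLinearModule

/-! ### Homogeneous ideals with a linear resolution -/

/-- The ideal `I` has a linear resolution with generators of degree `d`. -/
def IsLinearIdeal (I : Ideal A) (d : ℕ) : Prop :=
  ∃ p, IsLinearModule 𝒜 p I (I.piece (GradedAlgebra.proj 𝒜 d))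

namespace IsLinearIdeal

variable {𝒜} {I J : Ideal A} {d : ℕ}

/-- The product is an extension of `J` by `I`; monotonicity in the length brings both to `max p q`.
-/
theorem prod (hI : IsLinearIdeal 𝒜 I d) (hJ : IsLinearIdeal 𝒜 J d) :
    ∃ p, IsLinearModule 𝒜 p (Submodule.prod I J) ((Submodule.prod I J).piece
      ((GradedAlgebra.proj 𝒜 d).prodMap (GradedAlgebra.proj 𝒜 d))) := by
  obtain ⟨p, hp⟩ := hI
  obtain ⟨q, hq⟩ := hJ
  have hπ := isGradingFamily_proj 𝒜
  let f : I →ₗ[A] Submodule.prod I J :=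
    (LinearMap.inl A A A ∘ₗ I.subtype).codRestrict _ (fun x => ⟨x.2, J.zero_mem⟩)
  let g : Submodule.prod I J →ₗ[A] J :=
    (LinearMap.snd A A A ∘ₗ (Submodule.prod I J).subtype).codRestrict _ (fun x => x.2.2)
  have hf : Function.Injective f := fun x y hxy =>
    Subtype.ext (congrArg (fun z : Submodule.prod I J => z.1.1) hxy)
  have hfg : Function.Exact f g := by
    rintro ⟨⟨x, y⟩, hx, hy⟩
    constructor
    · intro h
      have hy0 : y = 0 := congrArg Subtype.val h
      subst hy0
      exact ⟨⟨x, hx⟩, rfl⟩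
    · rintro ⟨⟨z, hz⟩, h⟩
      refine Subtype.ext ?_
      exact (congrArg (fun z : Submodule.prod I J => z.1.2) h).symm
  refine ⟨max p q, IsLinearModule.of_exact f g hf ?_ hfg ?_ ?_ ?_ ?_
    (hp.mono (le_max_left p q)) (hq.mono (le_max_right p q))⟩
  · rintro ⟨y, hy⟩
    exact ⟨⟨(0, y), I.zero_mem, hy⟩, rfl⟩
  · rintro ⟨x, hx⟩
    rw [Submodule.mem_piece, Submodule.mem_piece]
    constructor
    · intro h
      exact congrArg Prod.fst h
    · intro h
      exact Prod.ext h (map_zero (GradedAlgebra.proj 𝒜 d))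
  · rintro x hx
    exact congrArg Prod.snd hx
  · rintro ⟨y, hy⟩ hyp
    exact ⟨⟨(0, y), I.zero_mem, hy⟩, Prod.ext (map_zero (GradedAlgebra.proj 𝒜 d)) hyp, rfl⟩
  · intro t ht h0
    obtain ⟨a, ha⟩ := (hfg _).1 h0
    have hfix := (hπ.prod 𝒜 hπ).cover_fixed (Submodule.prod I J) ht
    rw [← ha] at hfix
    obtain ⟨t', ht', hta⟩ := hπ.exists_cover_eq hp.span_eq_top 1 a (congrArg Prod.fst hfix)
    exact ⟨t', ht', by rw [hta, ha]⟩

/-- The diagonal map `I ⊓ J → I × J`. -/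
def diag (I J : Ideal A) : (I ⊓ J : Ideal A) →ₗ[A] Submodule.prod I J :=
  ((LinearMap.id.prod LinearMap.id) ∘ₗ (I ⊓ J).subtype).codRestrict _ (fun x => x.2)

/-- The difference map `I × J → I ⊔ J`. -/
def diff (I J : Ideal A) : Submodule.prod I J →ₗ[A] (I ⊔ J : Ideal A) :=
  ((LinearMap.fst A A A - LinearMap.snd A A A) ∘ₗ (Submodule.prod I J).subtype).codRestrict _
    (fun x => sub_mem (Submodule.mem_sup_left x.2.1) (Submodule.mem_sup_right x.2.2))

theorem diag_injective : Function.Injective (diag I J) := fun _ _ hxy =>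
  Subtype.ext (congrArg (fun z : Submodule.prod I J => z.1.1) hxy)

theorem diff_surjective : Function.Surjective (diff I J) := by
  rintro ⟨x, hx⟩
  obtain ⟨y, hy, z, hz, rfl⟩ := Submodule.mem_sup.1 hx
  exact ⟨⟨(y, -z), hy, J.neg_mem hz⟩, Subtype.ext (sub_neg_eq_add y z)⟩

theorem exact_diag_diff : Function.Exact (diag I J) (diff I J) := by
  rintro ⟨⟨x, y⟩, hx, hy⟩
  constructor
  · intro h
    have hxy : x = y := sub_eq_zero.1 (congrArg Subtype.val h)
    subst hxy
    exact ⟨⟨x, hx, hy⟩, rfl⟩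
  · rintro ⟨⟨z, hz⟩, h⟩
    rw [← h]
    exact Subtype.ext (sub_self z)

theorem diff_mem_piece (x : Submodule.prod I J) (hx : x ∈ (Submodule.prod I J).piece
    ((GradedAlgebra.proj 𝒜 d).prodMap (GradedAlgebra.proj 𝒜 d))) :
    diff I J x ∈ (I ⊔ J).piece (GradedAlgebra.proj 𝒜 d) := by
  rw [Submodule.mem_piece]
  change GradedAlgebra.proj 𝒜 d (x.1.1 - x.1.2) = x.1.1 - x.1.2
  rw [map_sub, show GradedAlgebra.proj 𝒜 d x.1.1 = x.1.1 from congrArg Prod.fst hx,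
    show GradedAlgebra.proj 𝒜 d x.1.2 = x.1.2 from congrArg Prod.snd hx]

theorem exists_diff_eq (hI : ∀ x ∈ I, GradedAlgebra.proj 𝒜 d x ∈ I)
    (hJ : ∀ x ∈ J, GradedAlgebra.proj 𝒜 d x ∈ J) (y : (I ⊔ J : Ideal A))
    (hy : y ∈ (I ⊔ J).piece (GradedAlgebra.proj 𝒜 d)) :
    ∃ x ∈ (Submodule.prod I J).piece ((GradedAlgebra.proj 𝒜 d).prodMap (GradedAlgebra.proj 𝒜 d)),
      diff I J x = y := by
  obtain ⟨⟨⟨a, b⟩, ha, hb⟩, rfl⟩ := diff_surjective y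
  refine ⟨⟨(GradedAlgebra.proj 𝒜 d a, GradedAlgebra.proj 𝒜 d b), hI a ha, hJ b hb⟩,
    Prod.ext (proj_proj 𝒜 d a) (proj_proj 𝒜 d b), Subtype.ext ?_⟩
  refine Eq.trans ?_ hy
  exact (map_sub (GradedAlgebra.proj 𝒜 d) a b).symm

/-- If the intersection and the sum of two homogeneous ideals are linear, then so are the ideals. -/
theorem of_inf_of_sup (hI : ∀ x ∈ I, GradedAlgebra.proj 𝒜 d x ∈ I)
    (hJ : ∀ x ∈ J, GradedAlgebra.proj 𝒜 d x ∈ J) (h₁ : IsLinearIdeal 𝒜 (I ⊓ J) d)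
    (h₂ : IsLinearIdeal 𝒜 (I ⊔ J) d) : IsLinearIdeal 𝒜 I d := by
  obtain ⟨p, hp⟩ := h₁
  obtain ⟨q, hq⟩ := h₂
  have hπ := isGradingFamily_proj 𝒜
  -- `I × J` is an extension of `I ⊔ J` by `I ⊓ J`, with generators in the same degree; `I` is then
  -- a retract of it.
  have key : IsLinearModule 𝒜 (max p q) (Submodule.prod I J) ((Submodule.prod I J).piece
      ((GradedAlgebra.proj 𝒜 d).prodMap (GradedAlgebra.proj 𝒜 d))) := by
    refine IsLinearModule.of_exact (diag I J) (diff I J) diag_injective diff_surjective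
      exact_diag_diff ?_ diff_mem_piece (exists_diff_eq hI hJ) ?_
      (hp.mono (le_max_left p q)) (hq.mono (le_max_right p q))
    · rintro ⟨x, hx⟩
      rw [Submodule.mem_piece, Submodule.mem_piece]
      exact ⟨fun h => congrArg Prod.fst h, fun h => Prod.ext h h⟩
    · intro t ht h0
      obtain ⟨a, ha⟩ := (exact_diag_diff _).1 h0
      have hfix := (hπ.prod 𝒜 hπ).cover_fixed (Submodule.prod I J) ht
      rw [← ha] at hfix
      obtain ⟨t', ht', hta⟩ := hπ.exists_cover_eq hp.span_eq_top 1 a (congrArg Prod.fst hfix)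
      exact ⟨t', ht', by rw [hta, ha]⟩
  let i : I →ₗ[A] Submodule.prod I J :=
    (LinearMap.inl A A A ∘ₗ I.subtype).codRestrict _ (fun x => ⟨x.2, J.zero_mem⟩)
  let r : Submodule.prod I J →ₗ[A] I :=
    (LinearMap.fst A A A ∘ₗ (Submodule.prod I J).subtype).codRestrict _ (fun x => x.2.1)
  refine ⟨max p q, IsLinearModule.of_retract i r (fun _ => rfl) (fun x hx => ?_) (fun x hx => ?_)
    key⟩
  · exact Prod.ext hx (map_zero (GradedAlgebra.proj 𝒜 d))
  · exact congrArg Prod.fst hx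

/-- The sum of two linear ideals generated in degree `d` is linear if their intersection is linear
and generated in degree `d + 1`. -/
theorem sup (hI : ∀ x ∈ I, GradedAlgebra.proj 𝒜 d x ∈ I)
    (hJ : ∀ x ∈ J, GradedAlgebra.proj 𝒜 d x ∈ J) (hIJ : ∀ x ∈ I ⊓ J, GradedAlgebra.proj 𝒜 d x = 0)
    (h₁ : IsLinearIdeal 𝒜 I d) (h₂ : IsLinearIdeal 𝒜 J d)
    (h₃ : IsLinearIdeal 𝒜 (I ⊓ J) (d + 1)) : IsLinearIdeal 𝒜 (I ⊔ J) d := by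
  obtain ⟨p, hp⟩ := prod h₁ h₂
  obtain ⟨q, hq⟩ := h₃
  have hπ := isGradingFamily_proj 𝒜
  refine ⟨max p q + 1, IsLinearModule.of_cokernel (diag I J) (diff I J) diag_injective
    diff_surjective exact_diag_diff diff_mem_piece (exists_diff_eq hI hJ) ?_ ?_
    (hq.mono (le_max_right p q)) (hp.mono (by lia))⟩
  · rintro ⟨⟨x, y⟩, hx, hy⟩ hxp h0
    have hxy : x = y := sub_eq_zero.1 (congrArg Subtype.val h0)
    subst hxy
    have h1 : GradedAlgebra.proj 𝒜 d x = x := congrArg Prod.fst hxp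
    have h2 : x = 0 := by rw [← h1]; exact hIJ x ⟨hx, hy⟩
    subst h2
    rfl
  · intro x
    constructor
    · intro hx
      have hx' : GradedAlgebra.proj 𝒜 (1 + d) x = x := by rw [add_comm 1 d]; exact hx
      exact (hπ.prod 𝒜 hπ).exists_cover_eq hp.span_eq_top 1 (diag I J x) (Prod.ext hx' hx')
    · rintro ⟨t, ht, htx⟩
      have hfix := (hπ.prod 𝒜 hπ).cover_fixed (Submodule.prod I J) ht
      rw [htx, add_comm 1 d] at hfix
      exact congrArg Prod.fst hfix

/-- The multiple of a linear ideal by a homogeneous nonzerodivisor is linear. -/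
theorem of_mul {x : A} {k : ℕ} (hx : x ∈ 𝒜 k) (hreg : ∀ a, x * a = 0 → a = 0)
    (hIJ : ∀ a, x * a ∈ J ↔ a ∈ I) (hJ : ∀ b ∈ J, x ∣ b) (h : IsLinearIdeal 𝒜 I d) :
    IsLinearIdeal 𝒜 J (d + k) := by
  obtain ⟨p, hp⟩ := h
  have hinj : ∀ {a b : A}, x * a = x * b → a = b := fun {a b} hab =>
    sub_eq_zero.1 (hreg _ (by rw [mul_sub, hab, sub_self]))
  let φ : I →ₗ[A] J := (LinearMap.mulLeft A x).restrict (fun a ha => (hIJ a).2 ha)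
  have hφ : Function.Bijective φ := by
    refine ⟨fun a b hab => Subtype.ext (hinj (congrArg Subtype.val hab)), ?_⟩
    rintro ⟨b, hb⟩
    obtain ⟨a, rfl⟩ := hJ b hb
    exact ⟨⟨a, (hIJ a).1 hb⟩, rfl⟩
  refine ⟨p, IsLinearModule.of_equiv (LinearEquiv.ofBijective φ hφ) (fun a => ?_) hp⟩
  have key : GradedAlgebra.proj 𝒜 (d + k) (x * (a : A)) = x * GradedAlgebra.proj 𝒜 d (a : A) := by
    rw [add_comm d k, GradedAlgebra.proj_apply, GradedAlgebra.proj_apply]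
    exact DirectSum.coe_decompose_mul_add_of_left_mem 𝒜 hx
  rw [Submodule.mem_piece, Submodule.mem_piece]
  change GradedAlgebra.proj 𝒜 (d + k) (x * (a : A)) = x * (a : A) ↔ _
  rw [key]
  exact ⟨hinj, congrArg _⟩

theorem bot (d : ℕ) : IsLinearIdeal 𝒜 (⊥ : Ideal A) d :=
  ⟨0, (inferInstance : Subsingleton (⊥ : Ideal A))⟩

end IsLinearIdeal

end LinearModules

/-! ### Monomial ideals determined by the supports of monomials. -/

namespace MvPolynomial

variable {V K : Type*} [Field K]

attribute [local instance] MvPolynomial.gradedAlgebra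

theorem proj_homogeneousSubmodule (n : ℕ) (f : MvPolynomial V K) :
    GradedAlgebra.proj (homogeneousSubmodule V K) n f = homogeneousComponent n f := by
  rw [GradedAlgebra.proj_apply]
  exact decomposition.decompose'_apply f n

variable [DecidableEq V]

variable (K) in
/-- The ideal of the polynomials all of whose monomials have their support in `F`. -/
def supportIdeal (F : Set (Finset V)) (hF : IsUpperSet F) : Ideal (MvPolynomial V K) where
  carrier := {f | ∀ m ∈ f.support, m.support ∈ F}
  add_mem' := by
    intro f g hf hg m hm
    rcases Finset.mem_union.1 (support_add hm) with h | h
    · exact hf m h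
    · exact hg m h
  zero_mem' := by simp
  smul_mem' := by
    intro c f hf m hm
    obtain ⟨a, _, b, hb, rfl⟩ := Finset.mem_add.1 (support_mul c f hm)
    exact hF (Finsupp.support_mono (self_le_add_left b a)) (hf b hb)

variable {F G : Set (Finset V)} {hF : IsUpperSet F} {hG : IsUpperSet G}

theorem mem_supportIdeal {f : MvPolynomial V K} :
    f ∈ supportIdeal K F hF ↔ ∀ m ∈ f.support, m.support ∈ F := Iff.rfl

theorem monomial_mem_supportIdeal {m : V →₀ ℕ} (hm : m.support ∈ F) (c : K) :
    monomial m c ∈ supportIdeal K F hF := by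
  intro m' hm'
  rwa [Finset.mem_singleton.1 (support_monomial_subset hm')]

theorem supportIdeal_inf :
    supportIdeal K F hF ⊓ supportIdeal K G hG = supportIdeal K (F ∩ G) (hF.inter hG) := by
  ext f
  simp only [Submodule.mem_inf, mem_supportIdeal, Set.mem_inter_iff]
  exact ⟨fun h m hm => ⟨h.1 m hm, h.2 m hm⟩,
    fun h => ⟨fun m hm => (h m hm).1, fun m hm => (h m hm).2⟩⟩

theorem supportIdeal_sup :
    supportIdeal K F hF ⊔ supportIdeal K G hG = supportIdeal K (F ∪ G) (hF.union hG) := by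
  apply le_antisymm
  · exact sup_le (fun f hf m hm => Or.inl (hf m hm)) (fun f hf m hm => Or.inr (hf m hm))
  · intro f hf
    rw [← support_sum_monomial_coeff f]
    refine sum_mem fun m hm => ?_
    rcases hf m hm with h | h
    · exact Submodule.mem_sup_left (monomial_mem_supportIdeal h _)
    · exact Submodule.mem_sup_right (monomial_mem_supportIdeal h _)

theorem homogeneousComponent_mem_supportIdeal (n : ℕ) {f : MvPolynomial V K}
    (hf : f ∈ supportIdeal K F hF) : homogeneousComponent n f ∈ supportIdeal K F hF := by
  intro m hm
  rw [support_homogeneousComponent] at hm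
  exact hf m (Finset.mem_filter.1 hm).1

theorem homogeneousComponent_eq_zero_of_mem_supportIdeal {n : ℕ} (hn : ∀ e ∈ F, n < e.card)
    {f : MvPolynomial V K} (hf : f ∈ supportIdeal K F hF) : homogeneousComponent n f = 0 := by
  refine homogeneousComponent_eq_zero' n f fun m hm => ?_
  have h1 := hn _ (hf m hm)
  have h2 : m.support.card ≤ m.degree := by
    rw [Finsupp.degree, Finset.card_eq_sum_ones]
    exact Finset.sum_le_sum fun i hi => Nat.one_le_iff_ne_zero.2 (Finsupp.mem_support_iff.1 hi)
  lia

variable (K) in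
/-- The ideal of an upper family of finite sets has a `d`-linear resolution. -/
def IsLinearFamily (F : Set (Finset V)) (d : ℕ) : Prop :=
  ∃ hF : IsUpperSet F, IsLinearIdeal (homogeneousSubmodule V K) (supportIdeal K F hF) d

namespace IsLinearFamily

variable {d : ℕ}

theorem of_inter_of_union (hF : IsUpperSet F) (hG : IsUpperSet G)
    (h₁ : IsLinearFamily K (F ∩ G) d) (h₂ : IsLinearFamily K (F ∪ G) d) :
    IsLinearFamily K F d := by
  obtain ⟨h1, h₁⟩ := h₁
  obtain ⟨h2, h₂⟩ := h₂
  rw [← supportIdeal_inf (hF := hF) (hG := hG)] at h₁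
  rw [← supportIdeal_sup (hF := hF) (hG := hG)] at h₂
  refine ⟨hF, IsLinearIdeal.of_inf_of_sup (fun x hx => ?_) (fun x hx => ?_) h₁ h₂⟩ <;>
  · rw [proj_homogeneousSubmodule]
    exact homogeneousComponent_mem_supportIdeal _ hx

theorem union (h₁ : IsLinearFamily K F d) (h₂ : IsLinearFamily K G d)
    (h₃ : IsLinearFamily K (F ∩ G) (d + 1)) (hcard : ∀ e ∈ F ∩ G, d < e.card) :
    IsLinearFamily K (F ∪ G) d := by
  obtain ⟨hF, h₁⟩ := h₁
  obtain ⟨hG, h₂⟩ := h₂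
  obtain ⟨h3, h₃⟩ := h₃
  rw [← supportIdeal_inf (hF := hF) (hG := hG)] at h₃
  refine ⟨hF.union hG, ?_⟩
  rw [← supportIdeal_sup (hF := hF) (hG := hG)]
  refine IsLinearIdeal.sup (fun x hx => ?_) (fun x hx => ?_) (fun x hx => ?_) h₁ h₂ h₃
  · rw [proj_homogeneousSubmodule]
    exact homogeneousComponent_mem_supportIdeal _ hx
  · rw [proj_homogeneousSubmodule]
    exact homogeneousComponent_mem_supportIdeal _ hx
  · rw [proj_homogeneousSubmodule]
    rw [supportIdeal_inf] at hx
    exact homogeneousComponent_eq_zero_of_mem_supportIdeal hcard hx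

theorem empty (d : ℕ) : IsLinearFamily K (∅ : Set (Finset V)) d := by
  refine ⟨isUpperSet_empty, ?_⟩
  have : supportIdeal K (∅ : Set (Finset V)) isUpperSet_empty = ⊥ := by
    rw [eq_bot_iff]
    intro f hf
    rw [Submodule.mem_bot, ← support_eq_empty]
    exact Finset.eq_empty_of_forall_notMem hf
  rw [this]
  exact IsLinearIdeal.bot d

/-- The ideal is the whole ring, free on `1`: the degree zero piece is `K · 1`, its cover is
injective, and one step suffices. -/
theorem univ : IsLinearFamily K (Set.univ : Set (Finset V)) 0 := by
  refine ⟨isUpperSet_univ, ?_⟩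
  set I := supportIdeal K (Set.univ : Set (Finset V)) isUpperSet_univ with hI
  let W := I.piece (GradedAlgebra.proj (homogeneousSubmodule V K) 0)
  let u : W := ⟨⟨1, fun _ _ => trivial⟩, by
    rw [Submodule.mem_piece, proj_homogeneousSubmodule]
    exact homogeneousComponent_eq_self (isHomogeneous_one V K)⟩
  have hu : ∀ x : W, ∃ c : K, x = c • u := by
    intro x
    have hx := x.2
    rw [Submodule.mem_piece, proj_homogeneousSubmodule, homogeneousComponent_zero] at hx
    refine ⟨coeff 0 ((x : I) : MvPolynomial V K), Subtype.ext (Subtype.ext ?_)⟩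
    change ((x : I) : MvPolynomial V K) = coeff 0 ((x : I) : MvPolynomial V K) • 1
    rw [smul_eq_C_mul, mul_one]
    exact hx.symm
  have ht : ∀ t : MvPolynomial V K ⊗[K] W, ∃ a, t = a ⊗ₜ[K] u := by
    intro t
    induction t with
    | zero => exact ⟨0, (zero_tmul _ _).symm⟩
    | add x y hx hy =>
      obtain ⟨a, rfl⟩ := hx
      obtain ⟨b, rfl⟩ := hy
      exact ⟨a + b, (add_tmul _ _ _).symm⟩
    | tmul a x =>
      obtain ⟨c, rfl⟩ := hu x
      exact ⟨c • a, (smul_tmul _ _ _).symm⟩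
  refine ⟨1, ?_, ?_⟩
  · rw [eq_top_iff]
    rintro ⟨x, hx⟩ -
    have : (⟨x, hx⟩ : I) = x • (u : I) := Subtype.ext (mul_one x).symm
    rw [this]
    exact Submodule.smul_mem _ _ (Submodule.subset_span u.2)
  · have h0 : ∀ s : LinearMap.ker (W.cover (MvPolynomial V K)), s = 0 := by
      rintro ⟨s, hs⟩
      obtain ⟨a, rfl⟩ := ht s
      rw [LinearMap.mem_ker, Submodule.cover_tmul] at hs
      have ha : a * 1 = 0 := congrArg Subtype.val hs
      rw [mul_one] at ha
      subst ha
      exact Subtype.ext (zero_tmul _ _)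
    exact ⟨fun x y => by rw [h0 x, h0 y]⟩

/-- Since membership in `F` ignores `n`, the new ideal is exactly `X n` times the ideal of `F`. -/
theorem mul_X {n : V} (hn : ∀ e, insert n e ∈ F → e ∈ F) (h : IsLinearFamily K F d) :
    IsLinearFamily K {e | n ∈ e ∧ e ∈ F} (d + 1) := by
  obtain ⟨hF, h⟩ := h
  have hF' : IsUpperSet {e | n ∈ e ∧ e ∈ F} := fun a b hab ha => ⟨hab ha.1, hF hab ha.2⟩
  have hsupp : ∀ m : V →₀ ℕ, (Finsupp.single n 1 + m).support = insert n m.support := by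
    intro m
    ext i
    by_cases hi : i = n
    · subst hi; simp
    · simp [hi]
  refine ⟨hF', IsLinearIdeal.of_mul (isHomogeneous_X K n)
    (fun a ha => (mul_eq_zero.1 ha).resolve_left (X_ne_zero n)) (fun f => ?_) (fun f hf => ?_) h⟩
  · rw [mem_supportIdeal, mem_supportIdeal, support_X_mul]
    simp only [Finset.mem_map, addLeftEmbedding_apply, forall_exists_index, and_imp,
      forall_apply_eq_imp_iff₂, hsupp]
    exact ⟨fun h m hm => hn _ (h m hm).2,
      fun h m hm => ⟨Finset.mem_insert_self _ _, hF (Finset.subset_insert _ _) (h m hm)⟩⟩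
  · have hf' : f ∈ Ideal.span (X '' {n} : Set (MvPolynomial V K)) := by
      rw [mem_ideal_span_X_image]
      exact fun m hm => ⟨n, rfl, Finsupp.mem_support_iff.1 (hf m hm).1⟩
    rwa [Set.image_singleton, Ideal.mem_span_singleton] at hf'

theorem mul_prod_X {σ : Finset V} (hσ : ∀ n ∈ σ, ∀ e, insert n e ∈ F → e ∈ F)
    (h : IsLinearFamily K F d) : IsLinearFamily K {e | σ ⊆ e ∧ e ∈ F} (d + σ.card) := by
  induction σ using Finset.induction_on with
  | empty => simpa using h
  | insert n σ hnσ ih =>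
    have h1 := ih (fun m hm => hσ m (Finset.mem_insert_of_mem hm))
    have h2 := mul_X (n := n) (fun e he => ?_) h1
    · rw [Finset.card_insert_of_notMem hnσ, ← add_assoc]
      convert h2 using 1
      ext e
      simp [Finset.insert_subset_iff, and_assoc]
    · refine ⟨?_, hσ n (Finset.mem_insert_self _ _) e he.2⟩
      rw [← Finset.erase_insert hnσ, ← Finset.subset_insert_iff]
      exact Finset.insert_subset (Finset.mem_insert_self _ _) he.1

/-- The squarefree monomials of degree `d` in a set of variables generate an ideal with a linear
resolution. -/
theorem le_card_inter (U : Finset V) (d : ℕ) :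
    IsLinearFamily K {e : Finset V | d ≤ (e ∩ U).card} d := by
  induction U using Finset.induction_on generalizing d with
  | empty =>
    cases d with
    | zero => simpa using univ
    | succ d => simpa using empty (d + 1)
  | insert n U hn ih =>
    cases d with
    | zero => simpa using univ
    | succ d =>
      have hcard : ∀ e : Finset V, n ∈ e → (e ∩ insert n U).card = (e ∩ U).card + 1 := by
        intro e he
        rw [Finset.inter_insert_of_mem he, Finset.card_insert_of_notMem (by simp [hn])]
      have hcard' : ∀ e : Finset V, n ∉ e → (e ∩ insert n U).card = (e ∩ U).card := by
        intro e he
        rw [Finset.inter_insert_of_notMem he]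
      have hind : ∀ k, ∀ e : Finset V, insert n e ∈ {e : Finset V | k ≤ (e ∩ U).card} →
          e ∈ {e : Finset V | k ≤ (e ∩ U).card} := by
        intro k e he
        rwa [Set.mem_ofPred_eq, Finset.insert_inter_of_notMem hn] at he
      have h1 := mul_X (hind d) (ih d)
      have h2 := mul_X (hind (d + 1)) (ih (d + 1))
      -- The family for `insert n U` in degree `d + 1` is the union of the family for `U` in degree
      -- `d + 1` and `X n` times that in degree `d`. They overlap in `X n` times the former,
      -- generated in degree `d + 2`, as `union` requires.
      have hinter : {e : Finset V | d + 1 ≤ (e ∩ U).card} ∩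
          {e | n ∈ e ∧ e ∈ {e : Finset V | d ≤ (e ∩ U).card}} =
          {e | n ∈ e ∧ e ∈ {e : Finset V | d + 1 ≤ (e ∩ U).card}} := by
        ext e
        simp only [Set.mem_inter_iff, Set.mem_ofPred_eq]
        constructor
        · rintro ⟨h, h', -⟩
          exact ⟨h', h⟩
        · rintro ⟨h, h'⟩
          exact ⟨h', h, by lia⟩
      have h3 := union (ih (d + 1)) h1 (by rwa [hinter]) (by
        rw [hinter]
        rintro e ⟨he, he'⟩
        have h4 := hcard e he
        have h5 := Finset.card_le_card (Finset.inter_subset_left : e ∩ insert n U ⊆ e)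
        have h6 : d + 1 ≤ (e ∩ U).card := he'
        lia)
      convert h3 using 1
      ext e
      simp only [Set.mem_union, Set.mem_ofPred_eq]
      by_cases he : n ∈ e
      · rw [hcard e he]
        simp only [he, true_and]
        lia
      · rw [hcard' e he]
        simp [he]

end IsLinearFamily

end MvPolynomial

/-! ### Complements of chordal clutters. -/

namespace UniformClutter

open MvPolynomial

variable {V K : Type*} [Field K] {d : ℕ}

/-- The sets that contain an edge. -/
def upperFamily (C : UniformClutter V d) : Set (Finset V) := {F | ∃ e ∈ C.edges, e ⊆ F}

theorem isUpperSet_upperFamily (C : UniformClutter V d) : IsUpperSet C.upperFamily :=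
  fun _ _ hab ⟨e, he, hea⟩ => ⟨e, he, hea.trans hab⟩

variable [DecidableEq V]

/-- A squarefree monomial divides another monomial if and only if its support is contained in the
other's. -/
theorem edgeIdeal_eq_supportIdeal (C : UniformClutter V d) :
    C.edgeIdeal K = supportIdeal K C.upperFamily C.isUpperSet_upperFamily := by
  have hset : {m : MvPolynomial V K | ∃ e ∈ C.edges, m = ∏ x ∈ e, X x} =
      (fun s => monomial s (1 : K)) '' ((fun e => ∑ x ∈ e, Finsupp.single x 1) '' C.edges) := by
    ext m
    simp only [Set.mem_ofPred_eq, Set.mem_image, exists_exists_and_eq_and, monomial_sum_one]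
    exact exists_congr fun e => and_congr_right fun _ => eq_comm
  ext f
  rw [edgeIdeal, hset, mem_ideal_span_monomial_image, mem_supportIdeal]
  refine forall₂_congr fun m _ => ?_
  simp only [Set.mem_image, exists_exists_and_eq_and]
  refine exists_congr fun e => and_congr_right fun _ => ?_
  have hval : ∀ i, (∑ x ∈ e, Finsupp.single x 1 : V →₀ ℕ) i = if i ∈ e then 1 else 0 := by
    intro i
    simp [Finsupp.finsetSum_apply, Finsupp.single_apply]
  constructor
  · intro h i hi
    have := h i
    rw [hval, if_pos hi] at this
    exact Finsupp.mem_support_iff.2 (by lia)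
  · intro h i
    rw [hval]
    split_ifs with hi
    · exact Nat.one_le_iff_ne_zero.2 (Finsupp.mem_support_iff.1 (h hi))
    · exact Nat.zero_le _

/-- The family of the sets properly containing `σ` plays the role of `J`. Simpliciality is used for
the intersection: a set `F ⊇ σ` inside the clique `N[σ]` contains no non-edge, whereas any `u ∈ F`
outside `N[σ]` yields the non-edge `insert u σ`. -/
theorem isLinearFamily_of_deletion [Fintype V] {C : UniformClutter V d} {σ : Finset V}
    (hσ : C.IsSimplicial σ)
    (h : IsLinearFamily K (C.deletion σ).complement.upperFamily d) :
    IsLinearFamily K C.complement.upperFamily d := by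
  classical
  obtain ⟨⟨hσd, -⟩, hcl⟩ := hσ
  set N := C.closedNeighborhood σ with hN
  have hσN : ∀ x ∈ σ, x ∈ N := fun x hx => Or.inl hx
  let U : Finset V := Finset.univ.filter (fun v => v ∉ N)
  have hB : IsUpperSet {F : Finset V | σ ⊂ F} := fun a b hab ha => lt_of_lt_of_le ha hab
  have hinter : C.complement.upperFamily ∩ {F : Finset V | σ ⊂ F} =
      {e | σ ⊆ e ∧ e ∈ {e : Finset V | 1 ≤ (e ∩ U).card}} := by
    ext F
    simp only [Set.mem_inter_iff, Set.mem_ofPred_eq, Nat.one_le_iff_ne_zero, ← Nat.pos_iff_ne_zero,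
      Finset.card_pos]
    constructor
    · rintro ⟨⟨e, ⟨hec, heC⟩, heF⟩, hσF⟩
      refine ⟨hσF.1, ?_⟩
      by_contra hne
      rw [Finset.not_nonempty_iff_eq_empty] at hne
      refine heC (hcl e (fun x hx => ?_) hec)
      by_contra hxN
      have : x ∈ F ∩ U := Finset.mem_inter.2 ⟨heF hx, by simp [U, hxN]⟩
      simp [hne] at this
    · rintro ⟨hσF, u, hu⟩
      rw [Finset.mem_inter] at hu
      obtain ⟨huF, huU⟩ := hu
      have huN : u ∉ N := (Finset.mem_filter.1 huU).2
      have huσ : u ∉ σ := fun h' => huN (hσN u h')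
      refine ⟨⟨insert u σ, ⟨?_, fun h' => huN (Or.inr h')⟩, Finset.insert_subset huF hσF⟩,
        hσF, fun h' => huσ (h' huF)⟩
      rw [Finset.card_insert_of_notMem huσ, hσd]
  have hunion : C.complement.upperFamily ∪ {F : Finset V | σ ⊂ F} =
      (C.deletion σ).complement.upperFamily := by
    ext F
    constructor
    · rintro (⟨e, ⟨hec, heC⟩, heF⟩ | hσF)
      · exact ⟨e, ⟨hec, fun h' => heC h'.1⟩, heF⟩
      · obtain ⟨v, hvF, hvσ⟩ := Finset.exists_of_ssubset hσF
        refine ⟨insert v σ, ⟨?_, fun h' => h'.2 (Finset.subset_insert v σ)⟩,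
          Finset.insert_subset hvF hσF.1⟩
        rw [Finset.card_insert_of_notMem hvσ, hσd]
    · rintro ⟨e, ⟨hec, heC⟩, heF⟩
      by_cases he : e ∈ C.edges
      · right
        have hσe : σ ⊆ e := by
          by_contra h'
          exact heC ⟨he, h'⟩
        refine lt_of_lt_of_le (lt_of_le_of_ne hσe ?_) heF
        rintro rfl
        lia
      · exact Or.inl ⟨e, ⟨hec, he⟩, heF⟩
  refine IsLinearFamily.of_inter_of_union C.complement.isUpperSet_upperFamily hB ?_
    (by rwa [hunion])
  -- The intersection is `x_σ` times an ideal generated by variables outside `σ`, so it is linear in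
  -- degree `1 + σ.card = d`.
  rw [hinter, ← hσd, add_comm σ.card 1]
  refine (IsLinearFamily.le_card_inter U 1).mul_prod_X fun n hn e he => ?_
  have hnU : n ∉ U := by simp [U, hσN n hn]
  rwa [Set.mem_ofPred_eq, Finset.insert_inter_of_notMem hnU] at he

theorem IsChordal.isLinearFamily_complement [Fintype V] {C : UniformClutter V d}
    (hC : C.IsChordal) : IsLinearFamily K C.complement.upperFamily d := by
  induction hC with
  | empty C hC =>
    convert IsLinearFamily.le_card_inter (K := K) (Finset.univ : Finset V) d using 1
    ext F
    simp only [Finset.inter_univ, Set.mem_ofPred_eq]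
    constructor
    · rintro ⟨e, ⟨he, -⟩, heF⟩
      exact he ▸ Finset.card_le_card heF
    · intro h
      obtain ⟨e, heF, he⟩ := Finset.exists_subset_card_eq h
      exact ⟨e, ⟨he, by simp [hC]⟩, heF⟩
  | step C σ hσ _ ih => exact isLinearFamily_of_deletion hσ ih

end UniformClutter

/-! ### From linear modules to resolutions by matrices of linear forms. -/

section LinearResolutions

universe u v

variable {V : Type u} {K : Type v} [Field K]

open MvPolynomial

attribute [local instance] MvPolynomial.gradedAlgebra

/-- The sequence of ranks `m, rank 0, rank 1, …`. -/
def consRank (m : ℕ) (rank : ℕ → ℕ) : ℕ → ℕ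
  | 0 => m
  | i + 1 => rank i

/-- The sequence of matrices `g, diff 0, diff 1, …`. -/
def consMatrix {R : Type*} {m : ℕ} {rank : ℕ → ℕ} (g : Matrix (Fin m) (Fin (rank 0)) R)
    (diff : (i : ℕ) → Matrix (Fin (rank i)) (Fin (rank (i + 1))) R) :
    (i : ℕ) → Matrix (Fin (consRank m rank i)) (Fin (consRank m rank (i + 1))) R
  | 0 => g
  | i + 1 => diff i

/-- All basis elements of `F_i` receive degree `i + d`. Minimality is automatic because linear forms
have no constant term. -/
theorem hasLinearResolution_of_matrices {I : Ideal (MvPolynomial V K)} {d m p : ℕ} {rank : ℕ → ℕ}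
    (gen : Fin m → MvPolynomial V K) (g : Matrix (Fin m) (Fin (rank 0)) (MvPolynomial V K))
    (diff : (i : ℕ) → Matrix (Fin (rank i)) (Fin (rank (i + 1))) (MvPolynomial V K))
    (hgen : ∀ k, (gen k).IsHomogeneous d) (hspan : Ideal.span (Set.range gen) = I)
    (h1 : Function.Exact g.mulVecLin (Fintype.linearCombination (MvPolynomial V K) gen))
    (h2 : Function.Exact (diff 0).mulVecLin g.mulVecLin)
    (h3 : ∀ i, Function.Exact (diff (i + 1)).mulVecLin (diff i).mulVecLin)
    (h4 : ∀ a b, (g a b).IsHomogeneous 1) (h5 : ∀ i a b, (diff i a b).IsHomogeneous 1)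
    (h6 : ∀ i, p ≤ i → rank i = 0) : HasLinearResolution I d := by
  have hdiff : ∀ i a b, (consMatrix g diff i a b).IsHomogeneous 1 := by
    intro i
    cases i with
    | zero => exact h4
    | succ i => exact h5 i
  refine ⟨{ rank := consRank m rank
            deg := fun i _ => i + d
            gen := gen
            diff := consMatrix g diff
            gen_homogeneous := fun k => by
              rw [zero_add]
              exact hgen k
            diff_homogeneous := fun i a b => Or.inr ⟨1, by lia, hdiff i a b⟩
            span_gen := hspan
            exact_zero := h1
            exact_succ := fun i => by
              cases i with
              | zero => exact h2
              | succ i => exact h3 i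
            finite_length := ⟨p, fun i hi => by
              cases i with
              | zero => lia
              | succ i => exact h6 i (by lia)⟩ }, fun i a b => ?_, fun i k hk => ?_⟩
  · rw [constantCoeff_eq]
    exact (hdiff i a b).coeff_eq_zero (by simp)
  · rw [GradedFreeResolution.betti, Fintype.card_eq_zero_iff]
    exact ⟨fun x => hk x.2.symm⟩

section Syzygies

variable {M : Type max u v} [AddCommGroup M] [Module K M] [Module (MvPolynomial V K) M]
  [IsScalarTower K (MvPolynomial V K) M]

/-- Subspaces of vectors of homogeneous polynomials of a given degree are finite-dimensional. -/
theorem finite_of_isHomogeneous [Finite V] {n d : ℕ}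
    {j : M →ₗ[MvPolynomial V K] (Fin n → MvPolynomial V K)} (hj : Function.Injective j)
    {W : Submodule K M} (hW : ∀ x ∈ W, ∀ i, (j x i).IsHomogeneous d) : Module.Finite K W := by
  have hfin : Module.Finite K (homogeneousSubmodule V K d) :=
    Module.Finite.iff_fg.2 (homogeneousSubmodule_fg _ _ d)
  let φ : W →ₗ[K] (Fin n → homogeneousSubmodule V K d) :=
    { toFun := fun x i => ⟨j x i, hW x x.2 i⟩
      map_add' := fun x y => by
        ext1 i
        exact Subtype.ext (by simp)
      map_smul' := fun c x => by
        ext1 i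
        refine Subtype.ext ?_
        exact congrFun (LinearMap.map_smul_of_tower j c (x : M)) i }
  refine Module.Finite.of_injective φ fun x y hxy => Subtype.ext (hj (funext fun i => ?_))
  exact congrArg Subtype.val (congrFun hxy i)

theorem span_range_basis {m : ℕ} {W : Submodule K M} (b : Module.Basis (Fin m) K W)
    (hW : Submodule.span (MvPolynomial V K) (W : Set M) = ⊤) :
    Submodule.span (MvPolynomial V K) (Set.range fun k => (b k : M)) = ⊤ := by
  rw [eq_top_iff, ← hW, Submodule.span_le]
  intro x hx
  have h : x = ∑ k, b.repr ⟨x, hx⟩ k • (b k : M) := by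
    have h' := congrArg Subtype.val (b.sum_repr ⟨x, hx⟩)
    rw [Submodule.coe_sum] at h'
    exact h'.symm
  rw [h]
  refine sum_mem fun k _ => ?_
  rw [← algebraMap_smul (MvPolynomial V K)]
  exact Submodule.smul_mem _ _ (Submodule.subset_span ⟨k, rfl⟩)

/-- The syzygies of a basis of generators, as vectors of polynomials. -/
theorem exists_syzygy_embedding {m : ℕ} {W : Submodule K M} (b : Module.Basis (Fin m) K W) :
    ∃ j : LinearMap.ker (W.cover (MvPolynomial V K)) →ₗ[MvPolynomial V K]
        (Fin m → MvPolynomial V K),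
      Function.Injective j ∧
      (∀ v, v ∈ LinearMap.range j ↔
        Fintype.linearCombination (MvPolynomial V K) (fun k => (b k : M)) v = 0) ∧
      ∀ s ∈ (LinearMap.ker (W.cover (MvPolynomial V K))).piece
        (tensorProj (homogeneousSubmodule V K) 1 W), ∀ i, (j s i).IsHomogeneous 1 := by
  let e := (b.baseChange (MvPolynomial V K)).equivFun
  have he : ∀ v, W.cover (MvPolynomial V K) (e.symm v) =
      Fintype.linearCombination (MvPolynomial V K) (fun k => (b k : M)) v := by
    intro v
    rw [Module.Basis.equivFun_symm_apply, map_sum, Fintype.linearCombination_apply]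
    exact Finset.sum_congr rfl fun k _ => by simp
  refine ⟨e.toLinearMap ∘ₗ (LinearMap.ker (W.cover (MvPolynomial V K))).subtype, ?_, ?_, ?_⟩
  · exact e.injective.comp Subtype.val_injective
  · intro v
    rw [← he, ← LinearMap.mem_ker]
    constructor
    · rintro ⟨s, rfl⟩
      have : e.symm (e (s : MvPolynomial V K ⊗[K] W)) = s := e.symm_apply_apply _
      change e.symm (e (s : MvPolynomial V K ⊗[K] W)) ∈ _
      rw [this]
      exact s.2
    · intro h
      exact ⟨⟨_, h⟩, e.apply_symm_apply v⟩
  · rintro ⟨s, hs⟩ hsp i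
    have key : ∀ t : MvPolynomial V K ⊗[K] W,
        e (tensorProj (homogeneousSubmodule V K) 1 W t) i = homogeneousComponent 1 (e t i) := by
      intro t
      induction t with
      | zero => simp
      | add x y hx hy => simp only [map_add, Pi.add_apply, hx, hy]
      | tmul a x =>
        simp only [e, tensorProj_tmul, proj_homogeneousSubmodule, Module.Basis.equivFun_apply,
          Module.Basis.baseChange_repr_tmul]
        rw [map_smul]
    have h1 : e s i = homogeneousComponent 1 (e s i) := by
      rw [← key]
      exact congrArg (fun t => e t i) (Eq.symm hsp)
    change (e s i).IsHomogeneous 1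
    rw [h1]
    exact homogeneousComponent_isHomogeneous 1 _

/-- A linear module of vectors of linear forms is the image of the first map of an exact sequence
of matrices of linear forms. -/
theorem IsLinearModule.exists_matrices [Finite V] (p : ℕ) :
    ∀ {M : Type max u v} [AddCommGroup M] [Module K M] [Module (MvPolynomial V K) M]
      [IsScalarTower K (MvPolynomial V K) M] {n : ℕ}
      (j : M →ₗ[MvPolynomial V K] (Fin n → MvPolynomial V K)) (W : Submodule K M),
      Function.Injective j → (∀ x ∈ W, ∀ i, (j x i).IsHomogeneous 1) →
      IsLinearModule (homogeneousSubmodule V K) p M W →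
      ∃ (rank : ℕ → ℕ) (g : Matrix (Fin n) (Fin (rank 0)) (MvPolynomial V K))
        (diff : (i : ℕ) → Matrix (Fin (rank i)) (Fin (rank (i + 1))) (MvPolynomial V K)),
        LinearMap.range g.mulVecLin = LinearMap.range j ∧
        Function.Exact (diff 0).mulVecLin g.mulVecLin ∧
        (∀ i, Function.Exact (diff (i + 1)).mulVecLin (diff i).mulVecLin) ∧
        (∀ a b, (g a b).IsHomogeneous 1) ∧ (∀ i a b, (diff i a b).IsHomogeneous 1) ∧
        ∀ i, p ≤ i → rank i = 0 := by
  induction p with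
  | zero =>
    intro M _ _ _ _ n j W hj hW hlin
    have : Subsingleton M := hlin
    refine ⟨fun _ => 0, 0, fun _ => 0, ?_, ?_, ?_, ?_, ?_, fun _ _ => rfl⟩
    · rw [Matrix.mulVecLin_zero, LinearMap.range_zero, Subsingleton.elim j 0, LinearMap.range_zero]
    · exact fun x => ⟨fun _ => ⟨0, Subsingleton.elim _ _⟩, fun _ => by simp⟩
    · exact fun _ x => ⟨fun _ => ⟨0, Subsingleton.elim _ _⟩, fun _ => by simp⟩
    · exact fun _ b => b.elim0
    · exact fun _ a => a.elim0
  | succ p ih =>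
    intro M _ _ _ _ n j W hj hW hlin
    have hfin := finite_of_isHomogeneous hj hW
    let b := Module.finBasis K W
    obtain ⟨j', hj', hr, hhom⟩ := exists_syzygy_embedding (V := V) b
    obtain ⟨rank, g, diff, h1, h2, h3, h4, h5, h6⟩ := ih j' _ hj' hhom hlin.2
    -- The columns are the vectors `j (b k)` of a basis of `W`. As `j` is injective, the kernel of
    -- `g₀` is the syzygy module of this basis, that is the range of `j'`, which the induction
    -- hypothesis resolves.
    let g₀ : Matrix (Fin n) (Fin (Module.finrank K W)) (MvPolynomial V K) :=
      Matrix.of fun a k => j (b k) a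
    have hg₀ : ∀ v, g₀.mulVecLin v =
        j (Fintype.linearCombination (MvPolynomial V K) (fun k => (b k : M)) v) := by
      intro v
      ext1 a
      simp [g₀, Fintype.linearCombination_apply, Matrix.mulVec, dotProduct, mul_comm]
    have hs : Function.Surjective
        (Fintype.linearCombination (MvPolynomial V K) (fun k => (b k : M))) := by
      rw [← LinearMap.range_eq_top, Fintype.range_linearCombination, span_range_basis b hlin.1]
    refine ⟨consRank (Module.finrank K W) rank, g₀, consMatrix g diff, ?_, ?_, ?_, ?_, ?_, ?_⟩
    · ext x
      constructor
      · rintro ⟨v, rfl⟩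
        exact ⟨_, (hg₀ v).symm⟩
      · rintro ⟨y, rfl⟩
        obtain ⟨v, rfl⟩ := hs y
        exact ⟨v, hg₀ v⟩
    · have h0 : Function.Exact g.mulVecLin g₀.mulVecLin := fun v => by
        rw [hg₀, map_eq_zero_iff j hj, ← hr, ← h1]
        rfl
      exact h0
    · intro i
      cases i with
      | zero => exact h2
      | succ i => exact h3 i
    · intro a k
      exact hW _ (b k).2 a
    · intro i
      cases i with
      | zero => exact h4
      | succ i => exact h5 i
    · intro i hi
      cases i with
      | zero => lia
      | succ i => exact h6 i (by lia)

end Syzygies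

theorem IsLinearIdeal.hasLinearResolution [Finite V] {I : Ideal (MvPolynomial V K)} {d : ℕ}
    (h : IsLinearIdeal (homogeneousSubmodule V K) I d) : HasLinearResolution I d := by
  obtain ⟨p, hp⟩ := h
  -- A successor length makes the two components `hp.1` and `hp.2` available, even if `p = 0`.
  replace hp := hp.mono (Nat.le_succ p)
  set W := I.piece (GradedAlgebra.proj (homogeneousSubmodule V K) d) with hWdef
  have hW : ∀ x ∈ W, (x : MvPolynomial V K).IsHomogeneous d := by
    intro x hx
    rw [hWdef, Submodule.mem_piece, proj_homogeneousSubmodule] at hx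
    rw [← hx]
    exact homogeneousComponent_isHomogeneous d _
  have hfin : Module.Finite K W := by
    refine finite_of_isHomogeneous (d := d) (n := 1)
      (j := LinearMap.pi fun _ => Submodule.subtype I) ?_ fun x hx _ => hW x hx
    exact fun x y hxy => Subtype.ext (congrFun hxy 0)
  let b := Module.finBasis K W
  obtain ⟨j, hj, hr, hhom⟩ := exists_syzygy_embedding (V := V) b
  obtain ⟨rank, g, diff, h1, h2, h3, h4, h5, h6⟩ :=
    IsLinearModule.exists_matrices p j _ hj hhom hp.2
  refine hasLinearResolution_of_matrices (fun k => ((b k : I) : MvPolynomial V K)) g diff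
    (fun k => hW _ (b k).2) ?_ ?_ h2 h3 h4 h5 h6
  · have h := congrArg (Submodule.map (Submodule.subtype I)) (span_range_basis b hp.1)
    rwa [Submodule.map_span, Submodule.map_top, Submodule.range_subtype, ← Set.range_comp] at h
  · intro v
    have hlc : Fintype.linearCombination (MvPolynomial V K)
        (fun k => ((b k : I) : MvPolynomial V K)) v =
        (Fintype.linearCombination (MvPolynomial V K) (fun k => (b k : I)) v : I) := by
      simp [Fintype.linearCombination_apply]
    rw [hlc, Submodule.coe_eq_zero, ← hr, ← h1]
    rfl

end LinearResolutions

theorem mainTheorem10 {V : Type*} [Fintype V] [DecidableEq V] (G : SimpleGraph V)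
    (hG : G.IsBlockGraph) (r : ℕ) (hr : 2 ≤ r) :
    (G.connectedClutter r).IsChordal ∧
      ∀ (K : Type*) [Field K],
        HasLinearResolution ((G.connectedClutter r).complement.edgeIdeal K) (r + 1) := by
  have hC := hG.isChordal_connectedClutter hr
  refine ⟨hC, fun K _ => ?_⟩
  obtain ⟨_, h⟩ := hC.isLinearFamily_complement (K := K)
  rw [UniformClutter.edgeIdeal_eq_supportIdeal]
  exact h.hasLinearResolution
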